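/- Let $G\subseteq \mathrm{PSL}_2(\mathbb R)$ be a Fuchsian group of the first kind (discrete, with a fundamental domain of finite hyperbolic area), $H\le G$ a subgroup of finite index $d$, and $G',H'$ the preimages of $G,H$ in $\mathrm{SL}_2(\mathbb R)$. Let $\gamma_1,\dots,\gamma_d\in G'$ represent the left cosets of $H'$ in $G'$. Let $\rho:H'\to \mathrm{GL}_m(\mathbb C)$ be a representation such that $\rho(\gamma)$ has only eigenvalues of modulus $1$ for every parabolic $\gamma\in H'$ (i.e. $|\mathrm{tr}\,\gamma|=2$), and let $k\in\mathbb Z$. Let $\widetilde\rho=\mathrm{Ind}_{H'}^{G'}\rho:G'\to \mathrm{GL}_{dm}(\mathbb C)$ be the induced representation, whose $(i,j)$ block at $g$ is $\rho(\gamma_i^{-1}g\gamma_j)$ if $\gamma_i^{-1}g\gamma_j\in H'$ and $0$ otherwise. Definitions. Put $(X|_k\gamma)(\tau)=(c\tau+d_0)^{-k}X(\gamma\tau)$ for $\gamma=\begin{pmatrix}a&b\\c&d_0\end{pmatrix}\in\mathrm{SL}_2(\mathbb R)$. For $\mathfrak c\in\mathbb R$ let $A_{\mathfrak c}=\begin{pmatrix}\mathfrak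 c&-1\\1&0\end{pmatrix}$, and let $A_\infty=I$. For a representation $\sigma$ on $\mathbb C^r$ of $\Gamma\in\{G',H'\}$ with only unimodular eigenvalues at parabolic elements, let $\mathrm M^!_k(\sigma)$ be the space of holomorphic $X:\mathbb H\to\mathbb C^r$ such that $X|_k\gamma=\sigma(\gamma)X$ for all $\gamma\in\Gamma$ and such that at every cusp $\mathfrak c$ of $\Gamma$, of width $h$ (the least $h>0$ with $t_{\mathfrak c}=A_{\mathfrak c}\begin{pmatrix}1&h\\0&1\end{pmatrix}A_{\mathfrak c}^{-1}\in\Gamma$), there is a convergent expansion on $\mathbb H$ $$X|_kA_{\mathfrak c}(\tau)=\sum_{\lambda}\ \sum_{j=0}^{m(\lambda)-1}(\log q)^j\, q^{\mu(\lambda)}\sum_{n\ge -M}a_{\lambda,j,n}\,q^n,\qquad q=e^{2\pi i\tau/h},\quad \log q=\frac{2\pi i\tau}{h},$$ with $M$ finite and $a_{\lambda,j,n}\in\mathbb C^r$. Here $\lambda$ runs over the eigenvalues of $\sigma(t_{\mathfrak c})$, $m(\lambda)$ is the size of the largest Jordan block for $\lambda$, and $\lambda=e^{2\pi i\mu(\lambda)}$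 with $0\le\mu(\lambda)<1$. Let $\mathrm M_{k,\mathrm{hol}}(\sigma)$ (respectively $\mathrm M_{k,\mathrm{cusp}}(\sigma)$) be the subspace of those $X$ for which the expansion at every cusp can be taken with only terms with $n\ge 0$ (respectively $n+\mu(\lambda)>0$). Let $R_{G'}$ be the ring of weakly holomorphic scalar-valued automorphic forms of weight $0$ on $G'$: the holomorphic $G'$-invariant functions $f$ on $\mathbb H$ such that at every cusp $\mathfrak c$ of $G'$ one has $|f(A_{\mathfrak c}\tau)|<e^{Cy}$ for $y=\mathrm{Im}\,\tau$ large, with some constant $C$. It acts on functions by multiplication, and $\mathrm M^!_k(\rho)$ and $\mathrm M^!_k(\widetilde\rho)$ are $R_{G'}$-modules. The lift of $X:\mathbb H\to\mathbb C^m$ in weight $k$ is $\widetilde X=(X|_k\gamma_i^{-1})_{1\le i\le d}$; for $k=0$ this is $\widetilde X(\tau)=(X(\gamma_i^{-1}\tau))_{1\le i\le d}$. Statement. The representation $\widetilde\rho$ again has only eigenvalues of modulus $1$ at the parabolic elements of $G'$. If $\rho$ is logarithmic (not diagonalizable at some parabolic element), so is $\widetilde\rho$. Moreover $\rho(-I)=(-1)^k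 I$ if and only if $\widetilde\rho(-I)=(-1)^k I$. Furthermore: 1. $X\mapsto\widetilde X$ is an isomorphism of $R_{G'}$-modules $\mathrm M^!_k(\rho)\to\mathrm M^!_k(\widetilde\rho)$; 2. $X\mapsto\widetilde X$ is a $\mathbb C$-linear isomorphism $\mathrm M_{0,\mathrm{hol}}(\rho)\to\mathrm M_{0,\mathrm{hol}}(\widetilde\rho)$; 3. $X\mapsto\widetilde X$ is a $\mathbb C$-linear isomorphism $\mathrm M_{0,\mathrm{cusp}}(\rho)\to\mathrm M_{0,\mathrm{cusp}}(\widetilde\rho)$. The isomorphisms in 2 and 3 are compatible with the partially defined multiplication by $R_{G'}$: for $f\in R_{G'}$ and $X$ in the source, $fX$ lies in the source if and only if $f\widetilde X$ lies in the target, and then $\widetilde{fX}=f\widetilde X$. If $\gamma_1=I$, the inverse of each of the three isomorphisms is $Y=(Y_1,\dots,Y_d)\mapsto Y_1$. -/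

import Mathlib

open UpperHalfPlane
open scoped MatrixGroups Manifold

noncomputable section

namespace VVAF

/-! ### Fuchsian groups of the first kind, cusps -/

/-- The preimage `G'` in `SL(2, ℝ)` of a subgroup `G` of `PSL(2, ℝ)`. -/
def preimageSL (G : Subgroup PSL(2, ℝ)) : Subgroup SL(2, ℝ) :=
  G.comap (QuotientGroup.mk' (Subgroup.center SL(2, ℝ)))

lemma preimageSL_mono {G H : Subgroup PSL(2, ℝ)} (h : H ≤ G) : preimageSL H ≤ preimageSL G :=
  Subgroup.comap_mono h

/-- `F` is a (measurable) fundamental domain for the action on `ℍ` of the image of `Γ` in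
`PSL(2, ℝ)`: the translates of `F` cover `ℍ`, and translates by elements with different images
in `PSL(2, ℝ)` overlap in a null set. -/
structure IsFundDomain (Γ : Subgroup SL(2, ℝ)) (F : Set ℍ) : Prop where
  measurableSet : MeasurableSet F
  covers : ∀ τ : ℍ, ∃ g ∈ Γ, g • τ ∈ F
  overlap : ∀ g ∈ Γ, g ≠ 1 → g ≠ -1 → MeasureTheory.volume {τ : ℍ | τ ∈ F ∧ g • τ ∈ F} = 0

/-- `G ⊆ PSL(2, ℝ)` is a Fuchsian group of the first kind: it is discrete (equivalently, its
preimage in `SL(2, ℝ)` is discrete) and has a fundamental domain of finite hyperbolic area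
(`volume` on `ℍ` is the measure `dx dy / y ^ 2`). -/
structure IsFuchsianFirstKind (G : Subgroup PSL(2, ℝ)) : Prop where
  discrete : DiscreteTopology (preimageSL G)
  finite_area : ∃ F : Set ℍ, IsFundDomain (preimageSL G) F ∧ MeasureTheory.volume F < ⊤

/-- `c ∈ ℝ ∪ {∞}` is a cusp of `Γ ⊆ SL(2, ℝ)`: it is fixed by a nontrivial parabolic element. -/
def IsCuspOf (Γ : Subgroup SL(2, ℝ)) (c : OnePoint ℝ) : Prop :=
  IsCusp c (Γ.map Matrix.SpecialLinearGroup.toGL)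

/-- The matrix `A_c` with `A_c ∞ = c`: the identity if `c = ∞`, and `(c, -1; 1, 0)` if `c ∈ ℝ`. -/
def cuspMatrix : OnePoint ℝ → SL(2, ℝ)
  | none => 1
  | some x => ⟨!![x, -1; 1, 0], by simp [Matrix.det_fin_two]⟩

/-- `t ^ h = (1, h; 0, 1)`. -/
def translation (h : ℝ) : SL(2, ℝ) := ⟨!![1, h; 0, 1], by simp [Matrix.det_fin_two]⟩

/-- `A_c t ^ h A_c⁻¹`. For `h` the cusp width of `c` this is the generator `t_c`. -/
def cuspTranslation (c : OnePoint ℝ) (h : ℝ) : SL(2, ℝ) :=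
  cuspMatrix c * translation h * (cuspMatrix c)⁻¹

/-- `h` is the cusp width of `c` in `Γ`: the least `h > 0` with `A_c t ^ h A_c⁻¹ ∈ Γ`. -/
def IsCuspWidth (Γ : Subgroup SL(2, ℝ)) (c : OnePoint ℝ) (h : ℝ) : Prop :=
  IsLeast {h : ℝ | 0 < h ∧ cuspTranslation c h ∈ Γ} h

lemma IsCuspWidth.mem {Γ : Subgroup SL(2, ℝ)} {c : OnePoint ℝ} {h : ℝ}
    (hh : IsCuspWidth Γ c h) : cuspTranslation c h ∈ Γ := hh.1.2

/-! ### Stroke operator, moderate growth, scalar-valued forms -/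

/-- The automorphy factor `j(γ, τ) = c τ + d`. -/
def jFactor (γ : SL(2, ℝ)) (τ : ℍ) : ℂ := (γ 1 0 : ℂ) * τ + (γ 1 1 : ℂ)

/-- The stroke operator `(X |_k γ)(τ) = j(γ, τ) ^ (-k) X(γ τ)`. -/
def stroke {V : Type*} [SMul ℂ V] (k : ℤ) (γ : SL(2, ℝ)) (X : ℍ → V) : ℍ → V :=
  fun τ => jFactor γ τ ^ (-k) • X (γ • τ)

/-- Moderate growth at `∞`. -/
def ModerateGrowth {V : Type*} [Norm V] (X : ℍ → V) : Prop :=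
  ∃ C Y : ℝ, 0 < Y ∧ ∀ τ : ℍ, Y < τ.im → ‖X τ‖ < Real.exp (C * τ.im)

/-- Weakly holomorphic scalar-valued automorphic forms of weight `0` on `Γ`: holomorphic
`Γ`-invariant functions on `ℍ` with moderate growth at every cusp of `Γ`. -/
structure IsScalarForm (Γ : Subgroup SL(2, ℝ)) (f : ℍ → ℂ) : Prop where
  holo : MDifferentiable 𝓘(ℂ) 𝓘(ℂ) f
  invariant : ∀ γ ∈ Γ, stroke 0 γ f = f
  growth : ∀ c, IsCuspOf Γ c → ModerateGrowth (stroke 0 (cuspMatrix c) f)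

lemma stroke_zero {V : Type*} [AddCommGroup V] [Module ℂ V] (γ : SL(2, ℝ)) (X : ℍ → V) (τ : ℍ) :
    stroke 0 γ X τ = X (γ • τ) := by simp [stroke]

lemma ModerateGrowth.add {X Y : ℍ → ℂ} (hX : ModerateGrowth X) (hY : ModerateGrowth Y) :
    ModerateGrowth (X + Y) := by
  obtain ⟨C, M, hM, h⟩ := hX
  obtain ⟨C', M', hM', h'⟩ := hY
  refine ⟨max C C' + 1, max (max M M') 1, by positivity, fun τ hτ => ?_⟩
  simp only [max_lt_iff] at hτ
  have h2 : (2 : ℝ) ≤ Real.exp τ.im := by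
    have := Real.add_one_le_exp τ.im
    linarith [hτ.2]
  have e1 : Real.exp (C * τ.im) ≤ Real.exp (max C C' * τ.im) :=
    Real.exp_le_exp.2 (mul_le_mul_of_nonneg_right (le_max_left _ _) τ.im_pos.le)
  have e2 : Real.exp (C' * τ.im) ≤ Real.exp (max C C' * τ.im) :=
    Real.exp_le_exp.2 (mul_le_mul_of_nonneg_right (le_max_right _ _) τ.im_pos.le)
  have e3 := Real.exp_pos (max C C' * τ.im)
  calc ‖(X + Y) τ‖ ≤ ‖X τ‖ + ‖Y τ‖ := norm_add_le _ _
    _ < Real.exp (max C C' * τ.im) * 2 := by linarith [h τ hτ.1.1, h' τ hτ.1.2]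
    _ ≤ Real.exp (max C C' * τ.im) * Real.exp τ.im := by gcongr
    _ = _ := by rw [← Real.exp_add]; ring_nf

lemma ModerateGrowth.mul {X Y : ℍ → ℂ} (hX : ModerateGrowth X) (hY : ModerateGrowth Y) :
    ModerateGrowth (X * Y) := by
  obtain ⟨C, M, hM, h⟩ := hX
  obtain ⟨C', M', hM', h'⟩ := hY
  refine ⟨C + C', max M M', by positivity, fun τ hτ => ?_⟩
  simp only [max_lt_iff] at hτ
  calc ‖(X * Y) τ‖ = ‖X τ‖ * ‖Y τ‖ := norm_mul _ _
    _ < Real.exp (C * τ.im) * Real.exp (C' * τ.im) :=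
        mul_lt_mul'' (h τ hτ.1) (h' τ hτ.2) (norm_nonneg _) (norm_nonneg _)
    _ = _ := by rw [← Real.exp_add]; ring_nf

lemma ModerateGrowth.const (z : ℂ) : ModerateGrowth (fun _ : ℍ => z) := by
  refine ⟨‖z‖, 1, one_pos, fun τ hτ => ?_⟩
  have := Real.add_one_le_exp (‖z‖ * τ.im)
  nlinarith [norm_nonneg z]

/-- The ring `R_Γ` of weakly holomorphic scalar-valued automorphic forms (of weight `0`). -/
def scalarRing (Γ : Subgroup SL(2, ℝ)) : Subalgebra ℂ (ℍ → ℂ) where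
  carrier := {f | IsScalarForm Γ f}
  mul_mem' := fun {f g} hf hg =>
    { holo := hf.holo.mul hg.holo
      invariant := fun γ hγ => by
        funext τ
        have h1 := congrFun (hf.invariant γ hγ) τ
        have h2 := congrFun (hg.invariant γ hγ) τ
        rw [stroke_zero] at *
        simp [h1, h2]
      growth := fun c hc => by
        convert! (hf.growth c hc).mul (hg.growth c hc) using 1
        funext τ
        simp [stroke_zero] }
  add_mem' := fun {f g} hf hg =>
    { holo := hf.holo.add hg.holo
      invariant := fun γ hγ => by
        funext τ
        have h1 := congrFun (hf.invariant γ hγ) τ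
        have h2 := congrFun (hg.invariant γ hγ) τ
        rw [stroke_zero] at *
        simp [h1, h2]
      growth := fun c hc => by
        convert! (hf.growth c hc).add (hg.growth c hc) using 1
        funext τ
        simp [stroke_zero] }
  algebraMap_mem' := fun z =>
    { holo := mdifferentiable_const
      invariant := fun γ _ => by
        funext τ
        simp [stroke_zero]
      growth := fun c _ => by
        convert! ModerateGrowth.const z using 1
        funext τ
        simp [stroke_zero] }

/-! ### Representations and logarithmic expansions -/

section Forms

variable {ι : Type*} [Fintype ι] [DecidableEq ι]

/-- `ρ` has only unitary eigenvalues at the parabolic elements (those with `|tr| = 2`). -/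
def UnitaryAtParabolics {Λ : Subgroup SL(2, ℝ)} (ρ : Λ →* GL ι ℂ) : Prop :=
  ∀ g : Λ, |(g : SL(2, ℝ)).val.trace| = 2 →
    ∀ z ∈ (ρ g).val.charpoly.roots, ‖z‖ = 1

/-- `T` is diagonalizable over `ℂ`. -/
def IsDiagonalizable (T : Matrix ι ι ℂ) : Prop :=
  ∃ (P : GL ι ℂ) (D : ι → ℂ), T = P.val * Matrix.diagonal D * (P⁻¹).val

/-- `ρ` is admissible: at the parabolic elements it has unitary eigenvalues and is
diagonalizable. -/
def IsAdmissible {Λ : Subgroup SL(2, ℝ)} (ρ : Λ →* GL ι ℂ) : Prop :=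
  UnitaryAtParabolics ρ ∧
    ∀ g : Λ, |(g : SL(2, ℝ)).val.trace| = 2 → IsDiagonalizable (ρ g).val

/-- `ρ` is logarithmic: at the parabolic elements it has unitary eigenvalues, and it is not
admissible. -/
def IsLogarithmic {Λ : Subgroup SL(2, ℝ)} (ρ : Λ →* GL ι ℂ) : Prop :=
  UnitaryAtParabolics ρ ∧ ¬ IsAdmissible ρ

/-- `ρ(-I) = (-1) ^ k ρ(I)` (whenever `-I` lies in the group). -/
def IsCompatible {Λ : Subgroup SL(2, ℝ)} (ρ : Λ →* GL ι ℂ) (k : ℤ) : Prop :=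
  ∀ g : Λ, (g : SL(2, ℝ)) = -1 → (ρ g).val = (-1 : ℂ) ^ k • (1 : Matrix ι ι ℂ)

/-- For unitary `z`, the unique `μ ∈ [0, 1)` with `z = exp (2 π i μ)`. -/
def mu (z : ℂ) : ℝ := Int.fract (z.arg / (2 * Real.pi))

/-- The size `m(z)` of the largest Jordan block of `T` for the eigenvalue `z`. -/
def blockSize (T : Matrix ι ι ℂ) (z : ℂ) : ℕ :=
  Module.End.maxGenEigenspaceIndex (Matrix.toLin' T) z

/-- The logarithmic expansion, with coefficients `a z j n`, of a function `F` on `ℍ`, where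
`q = exp (2 π i τ / h)`:
`F = ∑_z ∑_{j < m(z)} (log q) ^ j h_{z,j}` with `h_{z,j} = q ^ μ(z) ∑_n (a z j n) q ^ n`,
`z` running over the eigenvalues of `T` and `log q = 2 π i τ / h`. -/
def IsLogExpansion (T : Matrix ι ι ℂ) (h : ℝ) (F : ℍ → ι → ℂ) (a : ℂ → ℕ → ℤ → ι → ℂ) : Prop :=
  ∃ H : ℂ → ℕ → ℍ → ι → ℂ,
    (∀ z ∈ T.charpoly.roots, ∀ j < blockSize T z, ∀ τ : ℍ,
      HasSum (fun n : ℤ => Complex.exp (2 * Real.pi * Complex.I * τ / h * (mu z + n)) • a z j n)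
        (H z j τ)) ∧
    ∀ τ : ℍ, F τ = ∑ z ∈ T.charpoly.roots.toFinset, ∑ j ∈ Finset.range (blockSize T z),
      (2 * Real.pi * Complex.I * τ / h) ^ j • H z j τ

/-- The nonzero coefficients start from some finite `n`. -/
def MeromorphicCoeffs (T : Matrix ι ι ℂ) (a : ℂ → ℕ → ℤ → ι → ℂ) : Prop :=
  ∃ M : ℤ, ∀ z ∈ T.charpoly.roots, ∀ j < blockSize T z, ∀ n < M, a z j n = 0

/-- Only terms with `n ≥ 0` occur. -/
def HolomorphicCoeffs (T : Matrix ι ι ℂ) (a : ℂ → ℕ → ℤ → ι → ℂ) : Prop :=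
  ∀ z ∈ T.charpoly.roots, ∀ j < blockSize T z, ∀ n < 0, a z j n = 0

/-- Only terms `(log q) ^ j q ^ (μ(z) + n)` with `μ(z) + n > 0` occur, i.e. the terms that
tend to `0` at the cusp. -/
def CuspidalCoeffs (T : Matrix ι ι ℂ) (a : ℂ → ℕ → ℤ → ι → ℂ) : Prop :=
  ∀ z ∈ T.charpoly.roots, ∀ j < blockSize T z, ∀ n : ℤ, mu z + n ≤ 0 → a z j n = 0

/-- At every cusp `c` of `Λ` of width `h`, `X |_k A_c` has a logarithmic expansion with respect
to `ρ(t_c)` whose coefficients satisfy `P`. -/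
def ExpansionsAtCusps {Λ : Subgroup SL(2, ℝ)} (ρ : Λ →* GL ι ℂ) (k : ℤ)
    (P : Matrix ι ι ℂ → (ℂ → ℕ → ℤ → ι → ℂ) → Prop) (X : ℍ → ι → ℂ) : Prop :=
  ∀ c, IsCuspOf Λ c → ∀ (h : ℝ) (hh : IsCuspWidth Λ c h),
    ∃ a, IsLogExpansion (ρ ⟨cuspTranslation c h, hh.mem⟩).val h (stroke k (cuspMatrix c) X) a ∧
      P (ρ ⟨cuspTranslation c h, hh.mem⟩).val a

/-- `X` is a weakly holomorphic logarithmic vvaf (`P = MeromorphicCoeffs`), a holomorphic one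
(`P = HolomorphicCoeffs`), or a cusp form (`P = CuspidalCoeffs`), of weight `k` for `ρ`. -/
structure IsVVAF {Λ : Subgroup SL(2, ℝ)} (ρ : Λ →* GL ι ℂ) (k : ℤ)
    (P : Matrix ι ι ℂ → (ℂ → ℕ → ℤ → ι → ℂ) → Prop) (X : ℍ → ι → ℂ) : Prop where
  holo : MDifferentiable 𝓘(ℂ) 𝓘(ℂ, ι → ℂ) X
  functional : ∀ γ : Λ, stroke k γ X = fun τ => (ρ γ).val.mulVec (X τ)
  cusps : ExpansionsAtCusps ρ k P X

lemma IsVVAF.add {Λ : Subgroup SL(2, ℝ)} {ρ : Λ →* GL ι ℂ} {k : ℤ}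
    {P : Matrix ι ι ℂ → (ℂ → ℕ → ℤ → ι → ℂ) → Prop}
    (hP : ∀ T a b, P T a → P T b → P T (a + b)) {X Y : ℍ → ι → ℂ}
    (hX : IsVVAF ρ k P X) (hY : IsVVAF ρ k P Y) : IsVVAF ρ k P (X + Y) where
  holo := hX.holo.add hY.holo
  functional γ := by
    funext τ
    have h1 := congrFun (hX.functional γ) τ
    have h2 := congrFun (hY.functional γ) τ
    simp only [stroke] at h1 h2
    simp only [stroke, Pi.add_apply, smul_add, h1, h2, Matrix.mulVec_add]
  cusps c hc h hh := by
    obtain ⟨a, ⟨H, h1, h2⟩, ha⟩ := hX.cusps c hc h hh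
    obtain ⟨b, ⟨K, k1, k2⟩, hb⟩ := hY.cusps c hc h hh
    refine ⟨a + b, ⟨H + K, fun z hz j hj τ => ?_, fun τ => ?_⟩, hP _ _ _ ha hb⟩
    · simpa [smul_add] using (h1 z hz j hj τ).add (k1 z hz j hj τ)
    · have e1 := h2 τ
      have e2 := k2 τ
      simp only [stroke] at e1 e2
      simp only [stroke, Pi.add_apply, smul_add, e1, e2, Finset.sum_add_distrib]

lemma IsVVAF.smul {Λ : Subgroup SL(2, ℝ)} {ρ : Λ →* GL ι ℂ} {k : ℤ}
    {P : Matrix ι ι ℂ → (ℂ → ℕ → ℤ → ι → ℂ) → Prop}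
    (hP : ∀ T a (w : ℂ), P T a → P T (w • a)) (w : ℂ) {X : ℍ → ι → ℂ}
    (hX : IsVVAF ρ k P X) : IsVVAF ρ k P (w • X) where
  holo := hX.holo.const_smul w
  functional γ := by
    funext τ
    have h1 := congrFun (hX.functional γ) τ
    simp only [stroke] at h1
    simp only [stroke, Pi.smul_apply, smul_comm _ w, h1, Matrix.mulVec_smul]
  cusps c hc h hh := by
    obtain ⟨a, ⟨H, h1, h2⟩, ha⟩ := hX.cusps c hc h hh
    refine ⟨w • a, ⟨w • H, fun z hz j hj τ => ?_, fun τ => ?_⟩, hP _ _ _ ha⟩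
    · have := (h1 z hz j hj τ).const_smul w
      simp only [smul_comm w] at this
      exact this
    · have e1 := h2 τ
      simp only [stroke] at e1
      simp only [stroke, Pi.smul_apply, smul_comm _ w, e1, Finset.smul_sum]

lemma IsVVAF.zero {Λ : Subgroup SL(2, ℝ)} {ρ : Λ →* GL ι ℂ} {k : ℤ}
    {P : Matrix ι ι ℂ → (ℂ → ℕ → ℤ → ι → ℂ) → Prop}
    (hP : ∀ T, P T 0) : IsVVAF ρ k P 0 where
  holo := mdifferentiable_const
  functional γ := by
    funext τ
    simp [stroke]
  cusps c hc h hh := by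
    refine ⟨0, ⟨0, fun z hz j hj τ => ?_, fun τ => ?_⟩, hP _⟩
    · simp
    · simp [stroke]

lemma coe_translation_smul (h : ℝ) (τ : ℍ) : ((translation h • τ : ℍ) : ℂ) = τ + h := by
  rw [UpperHalfPlane.specialLinearGroup_apply]
  simp [translation]

/-- A holomorphic periodic function of moderate growth has a `q`-expansion with finite principal
part. -/
lemma exists_qExpansion {g : ℍ → ℂ} {h : ℝ} (hh : 0 < h)
    (hg : MDifferentiable 𝓘(ℂ) 𝓘(ℂ) g) (hper : ∀ τ : ℍ, g (translation h • τ) = g τ)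
    (hgr : ModerateGrowth g) :
    ∃ (N : ℕ) (b : ℕ → ℂ), ∀ τ : ℍ, HasSum
      (fun m : ℕ => b m * Complex.exp (2 * Real.pi * Complex.I * τ / h * ((m : ℂ) - N))) (g τ) := by
  obtain ⟨C, Y, hY, hC⟩ := hgr
  obtain ⟨N, hN⟩ := exists_nat_ge (C * h / (2 * Real.pi))
  have hN' : C ≤ 2 * Real.pi * N / h := by
    rw [div_le_iff₀ (by positivity)] at hN
    rw [le_div_iff₀ hh]
    linarith
  have hhc : (h : ℂ) ≠ 0 := by exact_mod_cast hh.ne'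
  set e : ℂ → ℂ := fun w => Complex.exp (2 * Real.pi * Complex.I * w / h * N) with he
  have hed : Differentiable ℂ e := by fun_prop
  set G : ℍ → ℂ := fun τ => g τ * e τ with hG
  have hGd : MDifferentiable 𝓘(ℂ) 𝓘(ℂ) G :=
    hg.mul (hed.mdifferentiable.comp UpperHalfPlane.mdifferentiable_coe)
  have hGper : Function.Periodic (G ∘ UpperHalfPlane.ofComplex) h := by
    intro w
    by_cases hw : 0 < w.im
    · have hw' : 0 < (w + h).im := by simpa using hw
      have e1 : UpperHalfPlane.ofComplex (w + h)
          = translation h • UpperHalfPlane.ofComplex w := by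
        apply UpperHalfPlane.ext
        rw [coe_translation_smul, UpperHalfPlane.ofComplex_apply_of_im_pos hw,
          UpperHalfPlane.ofComplex_apply_of_im_pos hw']
      simp only [Function.comp, e1, hG, hper, coe_translation_smul]
      congr 1
      simp only [he]
      rw [Complex.exp_eq_exp_iff_exists_int]
      exact ⟨N, by push_cast; field_simp⟩
    · have hw' : ¬ 0 < (w + h).im := by simpa using hw
      simp only [Function.comp]
      rw [UpperHalfPlane.ofComplex_apply_of_im_nonpos (not_lt.1 hw),
        UpperHalfPlane.ofComplex_apply_of_im_nonpos (not_lt.1 hw')]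
  have hGb : UpperHalfPlane.IsBoundedAtImInfty G := by
    rw [UpperHalfPlane.isBoundedAtImInfty_iff]
    refine ⟨1, Y + 1, fun τ hτ => ?_⟩
    have h1 := hC τ (by linarith)
    have h2 : ‖e τ‖ = Real.exp (-(2 * Real.pi * N / h) * τ.im) := by
      simp only [he]
      rw [Complex.norm_exp]
      congr 1
      have : (2 * Real.pi * Complex.I * (τ : ℂ) / h * N : ℂ)
          = ((2 * Real.pi * N / h : ℝ) : ℂ) * (Complex.I * τ) := by
        push_cast; ring
      rw [this, Complex.re_ofReal_mul]
      simp
    simp only [hG, norm_mul, h2]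
    calc ‖g τ‖ * Real.exp (-(2 * Real.pi * N / h) * τ.im)
        ≤ Real.exp (C * τ.im) * Real.exp (-(2 * Real.pi * N / h) * τ.im) := by gcongr
      _ = Real.exp ((C - 2 * Real.pi * N / h) * τ.im) := by rw [← Real.exp_add]; ring_nf
      _ ≤ 1 := Real.exp_le_one_iff.2
          (mul_nonpos_of_nonpos_of_nonneg (by linarith) τ.im_pos.le)
  refine ⟨N, fun m => (UpperHalfPlane.qExpansion h G).coeff m, fun τ => ?_⟩
  have hs := (UpperHalfPlane.hasSum_qExpansion hh hGper hGd hGb τ).mul_right (e τ)⁻¹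
  have e2 : G τ * (e τ)⁻¹ = g τ := mul_inv_cancel_right₀ (Complex.exp_ne_zero _) _
  rw [e2] at hs
  refine hs.congr_fun ?_
  intro m
  simp only [he, Function.Periodic.qParam, smul_eq_mul]
  rw [← Complex.exp_nat_mul, ← Complex.exp_neg, mul_assoc (PowerSeries.coeff m _), ← Complex.exp_add]
  congr 2
  ring

/-- The product of two Laurent series. -/
lemma hasSum_laurent_mul {b : ℕ → ℂ} {a : ℤ → ℂ} {N : ℕ} {M : ℤ} {w μ x y : ℂ}
    (hb : HasSum (fun m : ℕ => b m * Complex.exp (w * ((m : ℂ) - N))) x)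
    (ha : HasSum (fun n : ℤ => Complex.exp (w * (μ + n)) * a n) y)
    (h0 : ∀ n < M, a n = 0) :
    HasSum (fun n : ℤ => Complex.exp (w * (μ + n)) *
      ∑ m ∈ Finset.range (n + N - M + 1).toNat, b m * a (n + N - m)) (x * y) := by
  have hbn := hb.summable.norm
  have han := ha.summable.norm
  have hsm : Summable fun p : ℕ × ℤ => (b p.1 * Complex.exp (w * ((p.1 : ℂ) - N))) *
      (Complex.exp (w * (μ + p.2)) * a p.2) :=
    summable_mul_of_summable_norm
      (f := fun m : ℕ => b m * Complex.exp (w * ((m : ℂ) - N)))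
      (g := fun n : ℤ => Complex.exp (w * (μ + n)) * a n) hbn han
  have hprod := HasSum.mul hb ha hsm
  let E : ℤ × ℕ ≃ ℕ × ℤ :=
    { toFun := fun p => (p.2, p.1 + N - p.2)
      invFun := fun p => (p.2 + p.1 - N, p.1)
      left_inv := fun p => by ext <;> simp
      right_inv := fun p => by ext <;> simp }
  have hprod' := (E.hasSum_iff).2 hprod
  refine hprod'.prod_fiberwise fun n => ?_
  have hfin := hasSum_sum_of_ne_finset_zero
    (L := SummationFilter.unconditional ℕ) (s := Finset.range (n + N - M + 1).toNat)
    (f := fun m : ℕ => Complex.exp (w * (μ + n)) * (b m * a (n + N - m))) (fun m hm => by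
      simp only [Finset.mem_range, not_lt] at hm
      simp [h0 (n + N - m) (by omega)])
  rw [← Finset.mul_sum] at hfin
  refine hfin.congr_fun fun m => ?_
  simp only [E, Function.comp, Equiv.coe_fn_mk]
  have : Complex.exp (w * (μ + n)) = Complex.exp (w * ((m : ℂ) - N)) *
      Complex.exp (w * (μ + ((n + N - m : ℤ) : ℂ))) := by
    rw [← Complex.exp_add]
    congr 1
    push_cast
    ring
  rw [this]
  ring

lemma IsVVAF.ring_smul {Γ Λ : Subgroup SL(2, ℝ)} (hΛ : Λ ≤ Γ) {ρ : Λ →* GL ι ℂ} {k : ℤ}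
    {f : ℍ → ℂ} (hf : IsScalarForm Γ f) {X : ℍ → ι → ℂ}
    (hX : IsVVAF ρ k MeromorphicCoeffs X) : IsVVAF ρ k MeromorphicCoeffs (f • X) where
  holo := hf.holo.smul hX.holo
  functional γ := by
    funext τ
    have h1 := congrFun (hX.functional γ) τ
    have h2 := congrFun (hf.invariant γ (hΛ γ.2)) τ
    rw [stroke_zero] at h2
    simp only [stroke] at h1
    simp only [stroke, Pi.smul_apply', h2, smul_comm _ (f τ), h1, Matrix.mulVec_smul]
  cusps c hc h hh := by
    obtain ⟨a, ⟨H, h1, h2⟩, M, ha⟩ := hX.cusps c hc h hh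
    have hh0 : 0 < h := hh.1.1
    have hgd : MDifferentiable 𝓘(ℂ) 𝓘(ℂ) (stroke 0 (cuspMatrix c) f) := by
      have : stroke 0 (cuspMatrix c) f = f ∘ fun τ : ℍ =>
          (Matrix.SpecialLinearGroup.toGL (cuspMatrix c)) • τ := by
        funext τ
        rw [stroke_zero]
        rfl
      rw [this]
      exact hf.holo.comp (UpperHalfPlane.mdifferentiable_smul (by simp))
    have hper : ∀ τ : ℍ, stroke 0 (cuspMatrix c) f (translation h • τ)
        = stroke 0 (cuspMatrix c) f τ := by
      intro τ
      have h3 := congrFun (hf.invariant _ (hΛ hh.mem)) (cuspMatrix c • τ)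
      rw [stroke_zero] at h3
      rw [stroke_zero, stroke_zero, ← h3, smul_smul, smul_smul]
      simp [cuspTranslation]
    obtain ⟨N, b, hb⟩ := exists_qExpansion hh0 hgd hper
      (hf.growth c (hc.mono (Subgroup.map_mono hΛ)))
    refine ⟨fun z j n => ∑ m ∈ Finset.range (n + N - M + 1).toNat, b m • a z j (n + N - m),
      ⟨fun z j τ => f (cuspMatrix c • τ) • H z j τ, fun z hz j hj τ => ?_, fun τ => ?_⟩,
      M - N, fun z hz j hj n hn => ?_⟩
    · rw [Pi.hasSum]
      intro i
      have hsf := hb τ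
      rw [stroke_zero] at hsf
      have hsX := Pi.hasSum.1 (h1 z hz j hj τ) i
      simp only [Pi.smul_apply, smul_eq_mul] at hsX
      have := hasSum_laurent_mul (M := M) hsf hsX
        (fun n hn => by rw [ha z hz j hj n hn, Pi.zero_apply])
      simpa only [Pi.smul_apply, Finset.sum_apply, smul_eq_mul] using this
    · have e1 := h2 τ
      simp only [stroke] at e1
      simp only [stroke, Pi.smul_apply', smul_comm _ (f _), e1, Finset.smul_sum]
    · have : (n + N - M + 1).toNat = 0 := by omega
      simp [this]

/-- `M^!_k(ρ)`, the weakly holomorphic logarithmic vvaf of weight `k` for a representation `ρ` of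
a subgroup `Λ ≤ Γ`, as a module over the ring `R_Γ` acting by multiplication. -/
def weaklyHolForms {Γ Λ : Subgroup SL(2, ℝ)} (hΛ : Λ ≤ Γ) (k : ℤ) (ρ : Λ →* GL ι ℂ) :
    Submodule (scalarRing Γ) (ℍ → ι → ℂ) where
  carrier := {X | IsVVAF ρ k MeromorphicCoeffs X}
  add_mem' hX hY := hX.add (fun T a b ⟨M, ha⟩ ⟨M', hb⟩ => ⟨min M M', fun z hz j hj n hn => by
    simp [ha z hz j hj n (lt_of_lt_of_le hn (min_le_left _ _)),
      hb z hz j hj n (lt_of_lt_of_le hn (min_le_right _ _))]⟩) hY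
  zero_mem' := IsVVAF.zero fun T => ⟨0, fun _ _ _ _ _ _ => rfl⟩
  smul_mem' f _ hX := IsVVAF.ring_smul hΛ f.2 hX

/-- `M_{k,hol}(ρ)`, the holomorphic logarithmic vvaf of weight `k`. -/
def holForms {Λ : Subgroup SL(2, ℝ)} (k : ℤ) (ρ : Λ →* GL ι ℂ) :
    Submodule ℂ (ℍ → ι → ℂ) where
  carrier := {X | IsVVAF ρ k HolomorphicCoeffs X}
  add_mem' hX hY := hX.add (fun T a b ha hb z hz j hj n hn => by
    simp [ha z hz j hj n hn, hb z hz j hj n hn]) hY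
  zero_mem' := IsVVAF.zero fun T _ _ _ _ _ _ => rfl
  smul_mem' w _ hX := hX.smul (fun T a w ha z hz j hj n hn => by
    simp [ha z hz j hj n hn]) w

/-- `M_{k,cusp}(ρ)`, the logarithmic vector-valued cusp forms of weight `k`. -/
def cuspForms {Λ : Subgroup SL(2, ℝ)} (k : ℤ) (ρ : Λ →* GL ι ℂ) :
    Submodule ℂ (ℍ → ι → ℂ) where
  carrier := {X | IsVVAF ρ k CuspidalCoeffs X}
  add_mem' hX hY := hX.add (fun T a b ha hb z hz j hj n hn => by
    simp [ha z hz j hj n hn, hb z hz j hj n hn]) hY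
  zero_mem' := IsVVAF.zero fun T _ _ _ _ _ _ => rfl
  smul_mem' w _ hX := hX.smul (fun T a w ha z hz j hj n hn => by
    simp [ha z hz j hj n hn]) w

end Forms

/-! ### Induction and lifting -/

section Induction

variable {κ ι : Type*} [Fintype κ] [DecidableEq κ] [Fintype ι] [DecidableEq ι]

/-- `γ` is a complete system of representatives of the left cosets of `Λ` in `Γ`. -/
structure IsCosetReps (Γ Λ : Subgroup SL(2, ℝ)) (γ : κ → SL(2, ℝ)) : Prop where
  mem : ∀ i, γ i ∈ Γ
  existsUnique : ∀ g ∈ Γ, ∃! i, (γ i)⁻¹ * g ∈ Λ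

open Classical in
/-- `ρ` extended by the zero matrix outside `Λ`. -/
def extendByZero {Λ : Subgroup SL(2, ℝ)} (ρ : Λ →* GL ι ℂ) (g : SL(2, ℝ)) : Matrix ι ι ℂ :=
  if hg : g ∈ Λ then (ρ ⟨g, hg⟩).val else 0

lemma extendByZero_mul {Λ : Subgroup SL(2, ℝ)} (ρ : Λ →* GL ι ℂ) (g : SL(2, ℝ))
    {g' : SL(2, ℝ)} (hg' : g' ∈ Λ) :
    extendByZero ρ (g * g') = extendByZero ρ g * extendByZero ρ g' := by
  by_cases hg : g ∈ Λ
  · have : (⟨g * g', Λ.mul_mem hg hg'⟩ : Λ) = ⟨g, hg⟩ * ⟨g', hg'⟩ := rfl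
    rw [extendByZero, extendByZero, extendByZero, dif_pos hg, dif_pos hg',
      dif_pos (Λ.mul_mem hg hg'), this, map_mul, Units.val_mul]
  · simp [extendByZero, hg, (Subgroup.mul_mem_cancel_right Λ hg').not.2 hg]

/-- The block matrix with `(i, j)` block `ρ(γ_i⁻¹ g γ_j)`. -/
def inducedMatrix {Λ : Subgroup SL(2, ℝ)} (γ : κ → SL(2, ℝ)) (ρ : Λ →* GL ι ℂ)
    (g : SL(2, ℝ)) : Matrix (κ × ι) (κ × ι) ℂ :=
  Matrix.of fun p q => extendByZero ρ ((γ p.1)⁻¹ * g * γ q.1) p.2 q.2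

/-- The induced representation `ρ̃ = Ind_Λ^Γ ρ` in block form, with respect to the coset
representatives `γ`. -/
def inducedRep {Γ Λ : Subgroup SL(2, ℝ)} {γ : κ → SL(2, ℝ)} (hγ : IsCosetReps Γ Λ γ)
    (ρ : Λ →* GL ι ℂ) : Γ →* GL (κ × ι) ℂ :=
  MonoidHom.toHomUnits
    { toFun := fun g => inducedMatrix γ ρ g
      map_one' := by
        ext ⟨i, a⟩ ⟨j, b⟩
        simp only [inducedMatrix, Matrix.of_apply, OneMemClass.coe_one, mul_one]
        by_cases hij : i = j
        · subst hij
          have h1 : (⟨1, Λ.one_mem⟩ : Λ) = 1 := rfl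
          simp [extendByZero, Λ.one_mem, Matrix.one_apply, h1]
        · have : (γ i)⁻¹ * γ j ∉ Λ := fun h => hij
            ((hγ.existsUnique (γ j) (hγ.mem j)).unique h (by simp [Λ.one_mem]))
          simp [extendByZero, this, hij]
      map_mul' := fun g g' => by
        ext ⟨i, a⟩ ⟨j, b⟩
        obtain ⟨l, hl, hl'⟩ := hγ.existsUnique (g' * γ j) (Γ.mul_mem g'.2 (hγ.mem j))
        simp only [inducedMatrix, Matrix.of_apply, Matrix.mul_apply, Fintype.sum_prod_type,
          Subgroup.coe_mul]
        rw [Finset.sum_eq_single l]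
        · have e : (γ i)⁻¹ * (↑g * ↑g') * γ j
              = ((γ i)⁻¹ * g * γ l) * ((γ l)⁻¹ * (g' * γ j)) := by group
          rw [e, extendByZero_mul ρ _ hl, Matrix.mul_apply]
          simp only [mul_assoc]
        · intro l' _ hne
          have : (γ l')⁻¹ * (g' * γ j) ∉ Λ := fun h => hne (hl' l' h)
          refine Finset.sum_eq_zero fun x _ => ?_
          rw [mul_assoc (γ l')⁻¹]
          simp [extendByZero, this]
        · simp }

/-- The lift `X̃ = (X |_k γ_i⁻¹)_i`. In weight `0` its `i`-th block is `τ ↦ X(γ_i⁻¹ τ)`. -/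
def lift (k : ℤ) (γ : κ → SL(2, ℝ)) (X : ℍ → ι → ℂ) : ℍ → κ × ι → ℂ :=
  fun τ p => stroke k (γ p.1)⁻¹ X τ p.2

/-- The `i`-th block component of a function with values in `ℂ ^ (κ × ι)`. -/
def block (i : κ) (Y : ℍ → κ × ι → ℂ) : ℍ → ι → ℂ := fun τ a => Y τ (i, a)

end Induction

end VVAF

end

open VVAF

noncomputable section

set_option linter.unusedSectionVars false

namespace VVAF

/-! ### The stroke operator -/

/-! Write `Γ` and `Λ` for the two preimages. Away from the cusps the statement is Frobenius
reciprocity for functions. For `g ∈ Γ` and an index `i` there is exactly one `l` with `γ_i⁻¹ g γ_l ∈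
Λ`, so every block row of the induced matrix has a single nonzero block, and rewriting `γ_i⁻¹ g` as
an element of `Λ` times `γ_l⁻¹` gives the functional equation of the lift (`functional_lift`).
Conversely, the functional equation at `γ_i γ_j⁻¹` recovers block `j` from block `i`, so undoing the
stroke on one block inverts the lift (`descend_lift`, `lift_descend`).

The work lies at the cusps. A logarithmic expansion is tied to the cusp width and to the eigenvalues
and Jordan blocks of the matrix at `t_c`, and these differ for `Λ` and `Γ`. The proof passes to
`LogSeries`: finite sums of `τ ^ j` times series in `exp (2 π i e τ)` with real exponents `e`. This
notion does not mention the matrix, it is stable under affine changes of variable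
(`logSeries_comp_affine`), and it is insensitive to replacing the period by a commensurable one
(`logSeries_change_period`). The three growth conditions become conditions on the exponents: bounded
below, nonnegative, positive.

The way back to a genuine expansion is `exists_sum_of_shift_eq`: if `F(τ + h) = T F(τ)`,
independence of the generalized eigenspaces of the shift makes each component of `F` transform by
`T`, which leaves only eigenvalues of `T` and bounds the logarithmic degrees by the block sizes. The
resulting criterion `expansionsAtCusps_iff` is then transported between `c` and `γ_i^{±1} c` by an
upper triangular matrix, which scales widths and exponents by positive factors. -/

lemma jFactor_eq_denom (g : SL(2, ℝ)) (τ : ℍ) :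
    jFactor g τ = denom (Matrix.SpecialLinearGroup.toGL g) τ := rfl

lemma jFactor_mul (g g' : SL(2, ℝ)) (τ : ℍ) :
    jFactor (g * g') τ = jFactor g (g' • τ) * jFactor g' τ := by
  simp only [jFactor_eq_denom]
  rw [map_mul, denom_cocycle_σ]
  simp [σ]
  rfl

section Stroke

variable {V : Type*} [AddCommGroup V] [Module ℂ V]

lemma stroke_mul (k : ℤ) (g g' : SL(2, ℝ)) (X : ℍ → V) :
    stroke k (g * g') X = stroke k g' (stroke k g X) := by
  funext τ
  have h : (g * g') • τ = g • (g' • τ) := mul_smul g g' τ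
  simp only [stroke, h, jFactor_mul, mul_zpow]
  rw [mul_comm (jFactor g _ ^ (-k)), mul_smul]

lemma stroke_one (k : ℤ) (X : ℍ → V) : stroke k 1 X = X := by
  funext τ
  simp [stroke, jFactor]

lemma stroke_add (k : ℤ) (g : SL(2, ℝ)) (X Y : ℍ → V) :
    stroke k g (X + Y) = stroke k g X + stroke k g Y := by
  funext τ
  simp [stroke]

lemma stroke_mul_of_invariant (k : ℤ) (g : SL(2, ℝ)) {f : ℍ → ℂ} (hf : stroke 0 g f = f)
    (X : ℍ → V) : stroke k g (f • X) = f • stroke k g X := by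
  funext τ
  have h := congrFun hf τ
  rw [stroke_zero] at h
  simp only [stroke, Pi.smul_apply', h, smul_comm _ (f τ)]

end Stroke

lemma stroke_mulVec {ι κ : Type*} [Fintype ι] (k : ℤ) (g : SL(2, ℝ)) (T : Matrix κ ι ℂ)
    (X : ℍ → ι → ℂ) :
    stroke k g (fun τ => T.mulVec (X τ)) = fun τ => T.mulVec (stroke k g X τ) := by
  funext τ
  simp only [stroke, Matrix.mulVec_smul]

lemma mdifferentiable_stroke {V : Type*} [NormedAddCommGroup V] [NormedSpace ℂ V] (k : ℤ)
    (g : SL(2, ℝ)) {X : ℍ → V} (hX : MDifferentiable 𝓘(ℂ) 𝓘(ℂ, V) X) :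
    MDifferentiable 𝓘(ℂ) 𝓘(ℂ, V) (stroke k g X) := by
  have h1 := mdifferentiable_denom_zpow (Matrix.SpecialLinearGroup.toGL g) (-k)
  have h2 : MDifferentiable 𝓘(ℂ) 𝓘(ℂ, V)
      (X ∘ fun τ : ℍ => (Matrix.SpecialLinearGroup.toGL g) • τ) :=
    hX.comp (UpperHalfPlane.mdifferentiable_smul (by simp))
  exact h1.smul h2

lemma mdifferentiable_clm_comp {V W : Type*} [NormedAddCommGroup V] [NormedSpace ℂ V]
    [NormedAddCommGroup W] [NormedSpace ℂ W] (L : V →L[ℂ] W) {X : ℍ → V}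
    (hX : MDifferentiable 𝓘(ℂ) 𝓘(ℂ, V) X) :
    MDifferentiable 𝓘(ℂ) 𝓘(ℂ, W) (fun τ => L (X τ)) :=
  L.mdifferentiable.comp hX

lemma mdifferentiable_pi {ι : Type*} [Fintype ι] {X : ℍ → ι → ℂ} :
    MDifferentiable 𝓘(ℂ) 𝓘(ℂ, ι → ℂ) X ↔
      ∀ i, MDifferentiable 𝓘(ℂ) 𝓘(ℂ) (fun τ => X τ i) := by
  classical
  refine ⟨fun h i => mdifferentiable_clm_comp (ContinuousLinearMap.proj i) h, fun h => ?_⟩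
  have e : X = fun τ => ∑ i, X τ i • (Pi.single i 1 : ι → ℂ) := by
    funext τ
    exact (pi_eq_sum_univ' _)
  rw [e]
  have key : ∀ s : Finset ι, MDifferentiable 𝓘(ℂ) 𝓘(ℂ, ι → ℂ)
      (fun τ => ∑ i ∈ s, X τ i • (Pi.single i 1 : ι → ℂ)) := by
    intro s
    induction s using Finset.induction_on with
    | empty => simpa using mdifferentiable_const
    | insert a s ha ih =>
      simp only [Finset.sum_insert ha]
      exact ((h a).smul mdifferentiable_const).add ih
  exact key _

/-! ### Coset representatives and the induced representation -/

section Induction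

variable {κ ι : Type*} [Fintype κ] [DecidableEq κ] [Fintype ι] [DecidableEq ι]
variable {Γ Λ : Subgroup SL(2, ℝ)} {γ : κ → SL(2, ℝ)}

lemma IsCosetReps.exists_mem (hγ : IsCosetReps Γ Λ γ) {g : SL(2, ℝ)} (hg : g ∈ Γ) (i : κ) :
    ∃ l, (γ i)⁻¹ * g * γ l ∈ Λ := by
  obtain ⟨l, hl, -⟩ := hγ.existsUnique (g⁻¹ * γ i) (Γ.mul_mem (Γ.inv_mem hg) (hγ.mem i))
  refine ⟨l, ?_⟩
  have := Λ.inv_mem hl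
  simpa [mul_assoc] using this

lemma IsCosetReps.eq_of_mem (hγ : IsCosetReps Γ Λ γ) {g : SL(2, ℝ)} (hg : g ∈ Γ) {i l l' : κ}
    (h : (γ i)⁻¹ * g * γ l ∈ Λ) (h' : (γ i)⁻¹ * g * γ l' ∈ Λ) : l = l' := by
  refine (hγ.existsUnique (g⁻¹ * γ i) (Γ.mul_mem (Γ.inv_mem hg) (hγ.mem i))).unique ?_ ?_
  · simpa [mul_assoc] using Λ.inv_mem h
  · simpa [mul_assoc] using Λ.inv_mem h'

lemma IsCosetReps.nonempty (hγ : IsCosetReps Γ Λ γ) : Nonempty κ :=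
  let ⟨i, _⟩ := hγ.existsUnique 1 Γ.one_mem
  ⟨i⟩

/-- A uniform power of every element of `Γ` lies in `Λ`. -/
lemma IsCosetReps.exists_pow_mem (hγ : IsCosetReps Γ Λ γ) :
    ∃ D : ℕ, 0 < D ∧ ∀ g ∈ Γ, g ^ D ∈ Λ := by
  refine ⟨(Fintype.card κ).factorial, Nat.factorial_pos _, fun g hg => ?_⟩
  -- Pigeonhole: among the cosets of `g ^ 0, …, g ^ card κ` two coincide, so some `g ^ e` with `1 ≤
  -- e ≤ card κ` lies in `Λ`. Every such `e` divides the factorial, which makes the exponent uniform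
  -- in `g`.
  choose c hc using fun n : ℕ => (hγ.existsUnique (g ^ n) (Γ.pow_mem hg n)).exists
  have hmaps : ∀ n ∈ Finset.range (Fintype.card κ + 1), c n ∈ (Finset.univ : Finset κ) :=
    fun _ _ => Finset.mem_univ _
  obtain ⟨n, hn, n', hn', hne, he⟩ := Finset.exists_ne_map_eq_of_card_lt_of_maps_to
    (by simp) hmaps
  wlog hlt : n < n' generalizing n n'
  · exact this n' hn' n hn hne.symm he.symm (by omega)
  have h1 : g ^ (n' - n) ∈ Λ := by
    have h2 := Λ.mul_mem (Λ.inv_mem (hc n)) (he ▸ hc n')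
    have h3 : g ^ n' = g ^ n * g ^ (n' - n) := by rw [← pow_add]; congr 1; omega
    rw [h3] at h2
    simpa [mul_assoc] using h2
  have hdvd : n' - n ∣ (Fintype.card κ).factorial := by
    refine Nat.dvd_factorial (by omega) ?_
    simp only [Finset.mem_range] at hn'
    omega
  obtain ⟨e, he⟩ := hdvd
  rw [he, pow_mul]
  exact Λ.pow_mem h1 e

lemma inducedRep_val (hγ : IsCosetReps Γ Λ γ) (ρ : Λ →* GL ι ℂ) (g : Γ) :
    (inducedRep hγ ρ g).val = inducedMatrix γ ρ g := rfl

lemma extendByZero_of_mem (ρ : Λ →* GL ι ℂ) {g : SL(2, ℝ)} (hg : g ∈ Λ) :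
    extendByZero ρ g = (ρ ⟨g, hg⟩).val := dif_pos hg

lemma extendByZero_of_notMem (ρ : Λ →* GL ι ℂ) {g : SL(2, ℝ)} (hg : g ∉ Λ) :
    extendByZero ρ g = 0 := dif_neg hg

/-- Block row `i` of the induced matrix vanishes outside column `l`. All later computations with the
induced representation go through this formula. -/
lemma inducedRep_mulVec (hγ : IsCosetReps Γ Λ γ) (ρ : Λ →* GL ι ℂ) (g : Γ) {i l : κ}
    (h : (γ i)⁻¹ * g * γ l ∈ Λ) (v : κ × ι → ℂ) (a : ι) :
    (inducedRep hγ ρ g).val.mulVec v (i, a) =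
      (ρ ⟨_, h⟩).val.mulVec (fun b => v (l, b)) a := by
  rw [inducedRep_val]
  simp only [Matrix.mulVec, dotProduct, inducedMatrix, Matrix.of_apply, Fintype.sum_prod_type]
  rw [Finset.sum_eq_single l]
  · simp only [extendByZero_of_mem ρ h]
  · intro l' _ hl'
    rw [extendByZero_of_notMem ρ fun h' => hl' (hγ.eq_of_mem g.2 h' h)]
    simp
  · simp

/-! ### The lift and its inverse -/

lemma functional_lift (hγ : IsCosetReps Γ Λ γ) {ρ : Λ →* GL ι ℂ} {k : ℤ} {X : ℍ → ι → ℂ}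
    (hX : ∀ g : Λ, stroke k g X = fun τ => (ρ g).val.mulVec (X τ)) (g : Γ) :
    stroke k g (lift k γ X) = fun τ => (inducedRep hγ ρ g).val.mulVec (lift k γ X τ) := by
  funext τ ⟨i, a⟩
  obtain ⟨l, hl⟩ := hγ.exists_mem g.2 i
  rw [inducedRep_mulVec hγ ρ g hl]
  have e1 : stroke k g (lift k γ X) τ (i, a) = stroke k g (stroke k (γ i)⁻¹ X) τ a := rfl
  have e2 : (γ i)⁻¹ * g = ((γ i)⁻¹ * g * γ l) * (γ l)⁻¹ := by group
  have e3 : stroke k ((γ i)⁻¹ * g) X =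
      fun τ => (ρ ⟨_, hl⟩).val.mulVec (stroke k (γ l)⁻¹ X τ) := by
    conv_lhs => rw [e2]
    rw [stroke_mul, hX ⟨_, hl⟩, stroke_mulVec]
  rw [e1, ← stroke_mul, e3]
  rfl

/-- The inverse of the lift, read off from the block `i`. -/
def descend (k : ℤ) (γ : κ → SL(2, ℝ)) (i : κ) (Y : ℍ → κ × ι → ℂ) : ℍ → ι → ℂ :=
  stroke k (γ i) (block i Y)

lemma stroke_block (k : ℤ) (g : SL(2, ℝ)) (i : κ) (Y : ℍ → κ × ι → ℂ) :
    stroke k g (block i Y) = block i (stroke k g Y) := rfl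

lemma block_lift (k : ℤ) (i : κ) (X : ℍ → ι → ℂ) :
    block i (lift k γ X) = stroke k (γ i)⁻¹ X := rfl

lemma descend_lift (k : ℤ) (i : κ) (X : ℍ → ι → ℂ) : descend k γ i (lift k γ X) = X := by
  rw [descend, block_lift, ← stroke_mul, inv_mul_cancel, stroke_one]

lemma functional_block (hγ : IsCosetReps Γ Λ γ) {ρ : Λ →* GL ι ℂ} {k : ℤ} {Y : ℍ → κ × ι → ℂ}
    (hY : ∀ g : Γ, stroke k g Y = fun τ => (inducedRep hγ ρ g).val.mulVec (Y τ)) (g : Γ)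
    {i l : κ} (h : (γ i)⁻¹ * g * γ l ∈ Λ) :
    stroke k g (block i Y) = fun τ => (ρ ⟨_, h⟩).val.mulVec (block l Y τ) := by
  rw [stroke_block, hY]
  funext τ a
  exact inducedRep_mulVec hγ ρ g h (Y τ) a

lemma functional_descend (hγ : IsCosetReps Γ Λ γ) (hΛ : Λ ≤ Γ) {ρ : Λ →* GL ι ℂ} {k : ℤ}
    {Y : ℍ → κ × ι → ℂ}
    (hY : ∀ g : Γ, stroke k g Y = fun τ => (inducedRep hγ ρ g).val.mulVec (Y τ)) (i : κ) (g : Λ) :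
    stroke k g (descend k γ i Y) = fun τ => (ρ g).val.mulVec (descend k γ i Y τ) := by
  have hg : γ i * g * (γ i)⁻¹ ∈ Γ :=
    Γ.mul_mem (Γ.mul_mem (hγ.mem i) (hΛ g.2)) (Γ.inv_mem (hγ.mem i))
  have e : (γ i)⁻¹ * (γ i * g * (γ i)⁻¹) * γ i = g := by group
  have h := functional_block hγ hY ⟨_, hg⟩ (i := i) (l := i) (by rw [e]; exact g.2)
  have e2 : γ i * (g : SL(2, ℝ)) = (γ i * g * (γ i)⁻¹) * γ i := by group
  rw [descend, ← stroke_mul, e2, stroke_mul]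
  simp only [e] at h
  rw [h, stroke_mulVec]

/-- The element `γ_i γ_j⁻¹` carries block `i` to block `j` with trivial `Λ`-part, so no block holds
information beyond that of block `i`. -/
lemma lift_descend (hγ : IsCosetReps Γ Λ γ) {ρ : Λ →* GL ι ℂ} {k : ℤ} {Y : ℍ → κ × ι → ℂ}
    (hY : ∀ g : Γ, stroke k g Y = fun τ => (inducedRep hγ ρ g).val.mulVec (Y τ)) (i : κ) :
    lift k γ (descend k γ i Y) = Y := by
  funext τ ⟨j, a⟩
  have hg : γ i * (γ j)⁻¹ ∈ Γ := Γ.mul_mem (hγ.mem i) (Γ.inv_mem (hγ.mem j))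
  have e : (γ i)⁻¹ * (γ i * (γ j)⁻¹) * γ j = 1 := by group
  have h := functional_block hγ hY ⟨_, hg⟩ (i := i) (l := j) (by rw [e]; exact Λ.one_mem)
  simp only [e] at h
  have h1 : (⟨1, Λ.one_mem⟩ : Λ) = 1 := rfl
  have e1 : lift k γ (descend k γ i Y) τ (j, a) =
    stroke k (γ j)⁻¹ (stroke k (γ i) (block i Y)) τ a := rfl
  rw [e1, ← stroke_mul, h, h1]
  simp [block]

/-! ### Properties of the induced representation -/

/-- As `-1` is central and lies in `Λ`, the induced matrix at `-1` is block diagonal with all blocks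
equal to `ρ(-1)`. -/
lemma isCompatible_inducedRep_iff (hγ : IsCosetReps Γ Λ γ) (hΛ : Λ ≤ Γ)
    (hneg : (-1 : SL(2, ℝ)) ∈ Λ) (ρ : Λ →* GL ι ℂ) (k : ℤ) :
    IsCompatible ρ k ↔ IsCompatible (inducedRep hγ ρ) k := by
  have hi : ∀ i : κ, (γ i)⁻¹ * (-1) * γ i = -1 := fun i => by simp
  have hi' : ∀ i : κ, (γ i)⁻¹ * (-1) * γ i ∈ Λ := fun i => by rw [hi]; exact hneg
  constructor
  · intro h g hg
    have key : ∀ v, (inducedRep hγ ρ g).val.mulVec v =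
        ((-1 : ℂ) ^ k • (1 : Matrix (κ × ι) (κ × ι) ℂ)).mulVec v := by
      intro v
      funext ⟨i, a⟩
      rw [inducedRep_mulVec hγ ρ g (l := i) (by rw [hg]; exact hi' i),
        h ⟨_, _⟩ (by simp only [hg, hi])]
      simp [Matrix.smul_mulVec]
    exact Matrix.mulVec_injective (funext key)
  · intro h g hg
    obtain ⟨i⟩ := hγ.nonempty
    have key : ∀ v, (ρ g).val.mulVec v = ((-1 : ℂ) ^ k • (1 : Matrix ι ι ℂ)).mulVec v := by
      intro v
      funext a
      have h1 := inducedRep_mulVec hγ ρ ⟨-1, hΛ hneg⟩ (hi' i) (fun p => v p.2) a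
      rw [h _ rfl] at h1
      have h2 : (⟨_, hi' i⟩ : Λ) = g := Subtype.ext (by rw [hg]; exact hi i)
      simp only at h1
      rw [h2] at h1
      rw [← h1]
      simp [Matrix.smul_mulVec]
    exact Matrix.mulVec_injective (funext key)

lemma mem_roots_charpoly_iff {n : Type*} [Fintype n] [DecidableEq n] (T : Matrix n n ℂ) (z : ℂ) :
    z ∈ T.charpoly.roots ↔ ∃ v, v ≠ 0 ∧ T.mulVec v = z • v := by
  rw [Polynomial.mem_roots T.charpoly_monic.ne_zero, ← Matrix.charpoly_toLin',
    ← Module.End.hasEigenvalue_iff_isRoot_charpoly]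
  constructor
  · intro h
    obtain ⟨v, hv⟩ := h.exists_hasEigenvector
    exact ⟨v, hv.2, by simpa using hv.apply_eq_smul⟩
  · rintro ⟨v, hv, h⟩
    exact Module.End.hasEigenvalue_of_hasEigenvector
      (x := v) ⟨Module.End.mem_eigenspace_iff.2 (by simpa using h), hv⟩

lemma pow_mulVec_of_eigen {n : Type*} [Fintype n] [DecidableEq n] {T : Matrix n n ℂ} {z : ℂ}
    {v : n → ℂ} (h : T.mulVec v = z • v) (D : ℕ) : (T ^ D).mulVec v = z ^ D • v := by
  induction D with
  | zero => simp
  | succ D ih => rw [pow_succ, ← Matrix.mulVec_mulVec, h, Matrix.mulVec_smul, ih, smul_smul,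
      pow_succ, mul_comm]

/-- By Cayley–Hamilton `g = ε + N` with `ε = ±1` and `N² = 0`, so `g ^ n` is `ε ^ n` plus a multiple
of the traceless matrix `N`. -/
lemma abs_trace_pow (g : SL(2, ℝ)) (hg : |g.val.trace| = 2) (n : ℕ) :
    |(g ^ n).val.trace| = 2 := by
  have hdet := g.det_coe
  obtain ⟨ε, hε, htr⟩ : ∃ ε : ℝ, ε ^ 2 = 1 ∧ g.val.trace = 2 * ε := by
    rcases (abs_eq (by norm_num)).1 hg with h | h
    · exact ⟨1, by norm_num, by rw [h]; norm_num⟩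
    · exact ⟨-1, by norm_num, by rw [h]; norm_num⟩
  rw [Matrix.det_fin_two] at hdet
  rw [Matrix.trace_fin_two] at htr
  have key : ∃ s : ℝ, ((g ^ n : SL(2, ℝ)).val : Matrix (Fin 2) (Fin 2) ℝ) =
      ε ^ n • 1 + s • (g.val - ε • 1) := by
    induction n with
    | zero => exact ⟨0, by simp⟩
    | succ n ih =>
      obtain ⟨s, hs⟩ := ih
      refine ⟨ε ^ n + s * ε, ?_⟩
      have hN : (g.val - ε • 1) * (g.val - ε • (1 : Matrix (Fin 2) (Fin 2) ℝ)) = 0 := by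
        have h11 : g.val 1 1 = 2 * ε - g.val 0 0 := by linarith
        rw [h11] at hdet
        ext i j
        fin_cases i <;> fin_cases j <;> simp [Matrix.mul_apply, Fin.sum_univ_two, h11] <;>
          first | (ring; done) | linear_combination hε - hdet
      have hgd : g.val = ε • (1 : Matrix (Fin 2) (Fin 2) ℝ) + (g.val - ε • 1) := by abel
      have e1 : ((g ^ (n + 1) : SL(2, ℝ)).val : Matrix (Fin 2) (Fin 2) ℝ) =
          (g ^ n : SL(2, ℝ)).val * g.val := by rw [pow_succ]; rfl
      rw [e1, hs]
      generalize g.val - ε • (1 : Matrix (Fin 2) (Fin 2) ℝ) = N at hN hgd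
      rw [hgd]
      simp only [mul_add, add_mul, Matrix.smul_mul, Matrix.mul_smul, hN, one_mul, mul_one,
        smul_smul, smul_zero, add_zero, pow_succ, add_smul]
      module
  obtain ⟨s, hs⟩ := key
  have htr2 : (g ^ n).val.trace = 2 * ε ^ n := by
    rw [hs]
    simp only [Matrix.trace_add, Matrix.trace_smul, Matrix.trace_sub, Matrix.trace_one]
    rw [Matrix.trace_fin_two, htr]
    simp
    ring
  have habs : |ε| = 1 := by
    rw [← abs_one, ← sq_eq_sq_iff_abs_eq_abs, hε, one_pow]
  rw [htr2, abs_mul, abs_pow, habs]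
  norm_num

lemma trace_conj_eq (g x : SL(2, ℝ)) : (x⁻¹ * g * x).val.trace = g.val.trace := by
  have : ((x⁻¹ * g * x : SL(2, ℝ)).val : Matrix (Fin 2) (Fin 2) ℝ) = (x⁻¹).val * g.val * x.val :=
    rfl
  have h2 : x.val * (x⁻¹).val = 1 := by
    change (x * x⁻¹).val = 1
    rw [mul_inv_cancel]
    rfl
  rw [this, Matrix.trace_mul_comm, ← mul_assoc, h2, one_mul]

/-- For suitable `D` all conjugates `γ_i⁻¹ g ^ D γ_i` lie in `Λ`, so the induced matrix at `g ^ D`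
is block diagonal. A nonzero block of an eigenvector for `z` is then an eigenvector of some `ρ(γ_i⁻¹
g ^ D γ_i)` for `z ^ D`. This group element is again parabolic, hence `|z| ^ D = 1`. -/
lemma unitaryAtParabolics_inducedRep (hγ : IsCosetReps Γ Λ γ) {ρ : Λ →* GL ι ℂ}
    (hρ : UnitaryAtParabolics ρ) : UnitaryAtParabolics (inducedRep hγ ρ) := by
  intro g hg z hz
  obtain ⟨v, hv0, hv⟩ := (mem_roots_charpoly_iff _ _).1 hz
  obtain ⟨D, hD, hpow⟩ := hγ.exists_pow_mem
  have hmem : ∀ i, (γ i)⁻¹ * ((g ^ D : Γ) : SL(2, ℝ)) * γ i ∈ Λ := fun i => by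
    -- `Λ` need not be normal: the uniform `D` is applied to the conjugate of `g` in `Γ`, not to `g`
    -- itself.
    have e : (γ i)⁻¹ * ((g ^ D : Γ) : SL(2, ℝ)) * γ i = ((γ i)⁻¹ * g * γ i) ^ D := by
      have := conj_pow (i := D) (a := (γ i)⁻¹) (b := (g : SL(2, ℝ)))
      rw [inv_inv] at this
      rw [this, Subgroup.coe_pow]
    rw [e]
    exact hpow _ (Γ.mul_mem (Γ.mul_mem (Γ.inv_mem (hγ.mem i)) g.2) (hγ.mem i))
  obtain ⟨⟨i, a⟩, hia⟩ := Function.ne_iff.1 hv0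
  have hvD : (inducedRep hγ ρ (g ^ D)).val.mulVec v = z ^ D • v := by
    rw [map_pow, Units.val_pow_eq_pow_val]
    exact pow_mulVec_of_eigen hv D
  have h1 : z ^ D ∈ (ρ ⟨_, hmem i⟩).val.charpoly.roots := by
    refine (mem_roots_charpoly_iff _ _).2 ⟨fun b => v (i, b), fun h => hia (congrFun h a), ?_⟩
    funext b
    rw [← inducedRep_mulVec hγ ρ (g ^ D) (hmem i), hvD]
    rfl
  have h2 := hρ ⟨_, hmem i⟩ (by
    simp only [trace_conj_eq]
    exact abs_trace_pow g hg D) _ h1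
  rw [norm_pow] at h2
  exact (pow_eq_one_iff_of_nonneg (norm_nonneg z) hD.ne').1 h2

/-- A matrix is diagonalizable as soon as its eigenvectors span. -/
lemma isDiagonalizable_of_span {T : Matrix ι ι ℂ}
    (h : Submodule.span ℂ {v | ∃ z : ℂ, T.mulVec v = z • v} = ⊤) : IsDiagonalizable T := by
  set s := {v : ι → ℂ | ∃ z : ℂ, T.mulVec v = z • v}
  let b := Module.Basis.ofSpan h.ge
  have hb : ∀ i, b i ∈ s := fun i => Module.Basis.ofSpan_subset h.ge ⟨i, rfl⟩
  let e := b.indexEquiv (Pi.basisFun ℂ ι)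
  let c := b.reindex e
  have hc : ∀ i, ∃ z : ℂ, T.mulVec (c i) = z • c i := fun i => by
    simp only [c, Module.Basis.reindex_apply]
    exact hb _
  choose D hD using hc
  have hu : IsUnit (Matrix.of fun i j => c j i : Matrix ι ι ℂ) := by
    have h1 : ((Pi.basisFun ℂ ι).toMatrix c) = Matrix.of fun i j => c j i := by
      ext i j
      simp [Module.Basis.toMatrix_apply]
    rw [← h1]
    let := (Pi.basisFun ℂ ι).invertibleToMatrix c
    exact isUnit_of_invertible _
  obtain ⟨P, hP⟩ := hu
  refine ⟨P, D, ?_⟩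
  have h2 : T * P.val = P.val * Matrix.diagonal D := by
    ext i j
    rw [hP, Matrix.mul_diagonal]
    have := congrFun (hD j) i
    simpa [Matrix.mulVec, dotProduct, Matrix.mul_apply, mul_comm] using this
  rw [← h2, mul_assoc, ← Units.val_mul, mul_inv_cancel, Units.val_one, mul_one]

lemma IsDiagonalizable.span_eq_top {T : Matrix ι ι ℂ} (h : IsDiagonalizable T) :
    Submodule.span ℂ {v | ∃ z : ℂ, T.mulVec v = z • v} = ⊤ := by
  obtain ⟨P, D, rfl⟩ := h
  rw [eq_top_iff]
  intro w _
  have e : w = ∑ j, (P⁻¹).val.mulVec w j • P.val.col j := by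
    have : w = P.val.mulVec ((P⁻¹).val.mulVec w) := by
      rw [Matrix.mulVec_mulVec, ← Units.val_mul, mul_inv_cancel, Units.val_one, Matrix.one_mulVec]
    conv_lhs => rw [this]
    funext i
    simp [Matrix.mulVec, dotProduct, mul_comm]
  rw [e]
  refine Submodule.sum_mem _ fun j _ => Submodule.smul_mem _ _ (Submodule.subset_span ⟨D j, ?_⟩)
  have h1 : P.val.col j = P.val.mulVec (Pi.single j 1) := by simp
  rw [h1, Matrix.mulVec_mulVec, mul_assoc, ← Units.val_mul, inv_mul_cancel, Units.val_one, mul_one,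
    ← Matrix.mulVec_mulVec, ← Matrix.mulVec_smul]
  congr 1
  ext i
  simp [Pi.single_apply]

/-- Quotients of diagonalizable operators are diagonalizable: the images of a spanning set of
eigenvectors again satisfy an eigenvector equation and span. -/
lemma isDiagonalizable_of_surjective {n : Type*} [Fintype n] [DecidableEq n] {S : Matrix n n ℂ}
    {T : Matrix ι ι ℂ} (L : (n → ℂ) →ₗ[ℂ] (ι → ℂ)) (hL : Function.Surjective L)
    (hST : ∀ v, L (S.mulVec v) = T.mulVec (L v)) (h : IsDiagonalizable S) :
    IsDiagonalizable T := by
  refine isDiagonalizable_of_span ?_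
  rw [eq_top_iff, ← LinearMap.range_eq_top.2 hL, LinearMap.range_eq_map, ← h.span_eq_top,
    Submodule.map_span, Submodule.span_le]
  rintro _ ⟨v, ⟨z, hz⟩, rfl⟩
  exact Submodule.subset_span ⟨z, by rw [← hST, hz, map_smul]⟩

/-- Projection to block `i` intertwines the induced matrix at `γ_i g γ_i⁻¹` with `ρ(g)`, so
diagonalizability of the former passes to the latter. -/
lemma isLogarithmic_inducedRep (hγ : IsCosetReps Γ Λ γ) (hΛ : Λ ≤ Γ) {ρ : Λ →* GL ι ℂ}
    (hρ : IsLogarithmic ρ) : IsLogarithmic (inducedRep hγ ρ) := by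
  refine ⟨unitaryAtParabolics_inducedRep hγ hρ.1, fun hadm => hρ.2 ⟨hρ.1, fun g hg => ?_⟩⟩
  obtain ⟨i⟩ := hγ.nonempty
  have hg' : γ i * g * (γ i)⁻¹ ∈ Γ :=
    Γ.mul_mem (Γ.mul_mem (hγ.mem i) (hΛ g.2)) (Γ.inv_mem (hγ.mem i))
  have e : (γ i)⁻¹ * (γ i * g * (γ i)⁻¹) * γ i = g := by group
  have hd := hadm.2 ⟨_, hg'⟩ (by
    have := trace_conj_eq (γ i * g * (γ i)⁻¹) (γ i)
    rw [e] at this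
    simpa only [← this] using hg)
  refine isDiagonalizable_of_surjective (LinearMap.funLeft ℂ ℂ (fun a : ι => (i, a)))
    (LinearMap.funLeft_surjective_of_injective _ _ _ fun a b h => (Prod.ext_iff.1 h).2)
    (fun v => ?_) hd
  funext a
  have h1 := inducedRep_mulVec hγ ρ ⟨_, hg'⟩ (i := i) (l := i) (by rw [e]; exact g.2) v a
  simp only [e] at h1
  exact h1

end Induction

/-! ### Logarithmic series with real exponents -/

section LogSeries

variable {V W : Type*} [NormedAddCommGroup V] [NormedSpace ℂ V] [NormedAddCommGroup W]
  [NormedSpace ℂ W]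

/-- Functions on `ℍ` with an expansion `∑_e exp (2 π i e τ) a(e)` over real exponents `e` in `E`
such that `exp (2 π i e h) = z`. -/
def QSeries (V : Type*) [NormedAddCommGroup V] [NormedSpace ℂ V] (h : ℝ) (E : Set ℝ) (z : ℂ) :
    Submodule ℂ (ℍ → V) where
  carrier := {f | ∃ a : ℝ → V,
    (∀ e, a e ≠ 0 → e ∈ E ∧ Complex.exp (2 * Real.pi * Complex.I * e * h) = z) ∧
    ∀ τ : ℍ, HasSum (fun e : ℝ => Complex.exp (2 * Real.pi * Complex.I * e * τ) • a e) (f τ)}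
  add_mem' := by
    rintro f g ⟨a, ha, hf⟩ ⟨b, hb, hg⟩
    refine ⟨a + b, fun e he => ?_, fun τ => ?_⟩
    · by_cases h0 : a e = 0
      · exact hb e fun h1 => he (by simp [h0, h1])
      · exact ha e h0
    · simpa [smul_add] using (hf τ).add (hg τ)
  zero_mem' := ⟨0, fun e he => (he rfl).elim, fun τ => by simp⟩
  smul_mem' := by
    rintro c f ⟨a, ha, hf⟩
    refine ⟨c • a, fun e he => ha e fun h1 => he (by simp [h1]), fun τ => ?_⟩
    have := (hf τ).const_smul c
    simp only [smul_comm c] at this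
    exact this

/-- Multiplication by `τ ^ j`. -/
def mulPow (V : Type*) [AddCommGroup V] [Module ℂ V] (j : ℕ) : (ℍ → V) →ₗ[ℂ] (ℍ → V) where
  toFun f τ := (τ : ℂ) ^ j • f τ
  map_add' f g := by funext τ; simp
  map_smul' c f := by funext τ; simp [smul_comm c]

lemma mulPow_apply (j : ℕ) (f : ℍ → V) (τ : ℍ) : mulPow V j f τ = (τ : ℂ) ^ j • f τ := rfl

/-- Finite sums of functions `τ ^ j f`, with `f` in some `QSeries V h E z`. -/
def LogSeries (V : Type*) [NormedAddCommGroup V] [NormedSpace ℂ V] (h : ℝ) (E : Set ℝ) :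
    Submodule ℂ (ℍ → V) :=
  ⨆ p : ℂ × ℕ, (QSeries V h E p.1).map (mulPow V p.2)

lemma mulPow_mem_logSeries {h : ℝ} {E : Set ℝ} {z : ℂ} {f : ℍ → V} (hf : f ∈ QSeries V h E z)
    (j : ℕ) : mulPow V j f ∈ LogSeries V h E :=
  Submodule.mem_iSup_of_mem (z, j) (Submodule.mem_map_of_mem hf)

lemma logSeries_le_iff {h : ℝ} {E : Set ℝ} {S : Submodule ℂ (ℍ → V)} :
    LogSeries V h E ≤ S ↔ ∀ z, ∀ f ∈ QSeries V h E z, ∀ j, mulPow V j f ∈ S := by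
  refine ⟨fun H z f hf j => H (mulPow_mem_logSeries hf j), fun H => iSup_le fun p => ?_⟩
  rintro _ ⟨f, hf, rfl⟩
  exact H _ f hf _

lemma qSeries_mono {h : ℝ} {E E' : Set ℝ} (hE : E ⊆ E') (z : ℂ) :
    QSeries V h E z ≤ QSeries V h E' z := by
  rintro f ⟨a, ha, hf⟩
  exact ⟨a, fun e he => ⟨hE (ha e he).1, (ha e he).2⟩, hf⟩

lemma logSeries_mono {h : ℝ} {E E' : Set ℝ} (hE : E ⊆ E') :
    LogSeries V h E ≤ LogSeries V h E' :=
  logSeries_le_iff.2 fun z _ hf j => mulPow_mem_logSeries (qSeries_mono hE z hf) j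

/-- A series with exponents in finitely many classes splits into series with exponents in a
single class. -/
lemma logSeries_change_period [CompleteSpace V] {h h' : ℝ} {D n : ℕ} (hn : 0 < n)
    (hD : D * h = n * h') (E : Set ℝ) : LogSeries V h E ≤ LogSeries V h' E := by
  classical
  refine logSeries_le_iff.2 fun z f hf j => ?_
  obtain ⟨a, ha, hf⟩ := hf
  let c : ℝ → ℂ := fun e => Complex.exp (2 * Real.pi * Complex.I * e * h')
  -- Since `D h = n h'`, the new label `exp (2 π i e h')` of an occurring exponent has `n`-th power
  -- `z ^ D`, so only finitely many labels appear.
  let S : Finset ℂ := (Polynomial.nthRoots n (z ^ D)).toFinset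
  have hS : ∀ e, a e ≠ 0 → c e ∈ S := fun e he => by
    rw [Multiset.mem_toFinset, Polynomial.mem_nthRoots hn, ← (ha e he).2, ← Complex.exp_nat_mul,
      ← Complex.exp_nat_mul]
    congr 1
    have : (D : ℂ) * h = n * h' := by exact_mod_cast hD
    linear_combination (-2 * Real.pi * Complex.I * e) * this
  have hsum : ∀ (w : ℂ) (τ : ℍ), Summable fun e : ℝ =>
      Complex.exp (2 * Real.pi * Complex.I * e * τ) • (if c e = w then a e else 0) := by
    intro w τ
    have := (hf τ).summable.indicator {e | c e = w}
    convert! this using 2 with e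
    by_cases h1 : c e = w <;> simp [h1]
  let g : ℂ → ℍ → V := fun w τ => ∑' e : ℝ,
      Complex.exp (2 * Real.pi * Complex.I * e * τ) • (if c e = w then a e else 0)
  have hg : ∀ w, g w ∈ QSeries V h' E w := fun w =>
    ⟨fun e => if c e = w then a e else 0, fun e he => by
      dsimp only at he
      by_cases h1 : c e = w
      · rw [if_pos h1] at he
        exact ⟨(ha e he).1, h1⟩
      · simp [h1] at he, fun τ => (hsum w τ).hasSum⟩
  have hfg : f = ∑ w ∈ S, g w := by
    funext τ
    have h1 := hasSum_sum (s := S) fun w _ => (hsum w τ).hasSum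
    rw [Finset.sum_apply]
    refine (hf τ).unique ?_
    convert! h1 using 2 with e
    rw [← Finset.smul_sum]
    congr 1
    rw [Finset.sum_ite_eq]
    by_cases h0 : a e = 0
    · simp [h0]
    · rw [if_pos (hS e h0)]
  rw [hfg, map_sum]
  exact Submodule.sum_mem _ fun w _ => mulPow_mem_logSeries (hg w) j

/-- Logarithmic series are stable under affine changes of the variable. -/
lemma logSeries_comp_affine {h r b : ℝ} (hr : r ≠ 0) {E E' : Set ℝ}
    (hE : ∀ e ∈ E, r * e ∈ E') {B : ℍ → ℍ} (hB : ∀ τ : ℍ, (B τ : ℂ) = r * τ + b)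
    {F : ℍ → V} (hF : F ∈ LogSeries V h E) : F ∘ B ∈ LogSeries V (h / r) E' := by
  have hrc : (r : ℂ) ≠ 0 := by exact_mod_cast hr
  suffices LogSeries V h E ≤ (LogSeries V (h / r) E').comap (LinearMap.funLeft ℂ V B) from
    this hF
  refine logSeries_le_iff.2 fun z f hf j => ?_
  obtain ⟨a, ha, hf⟩ := hf
  have hfB : f ∘ B ∈ QSeries V (h / r) E' z := by
    refine ⟨fun e => Complex.exp (2 * Real.pi * Complex.I * (e / r) * b) • a (e / r),
      fun e he => ?_, fun τ => ?_⟩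
    · have h1 := ha (e / r) fun h0 => he (by simp [h0])
      refine ⟨?_, ?_⟩
      · have := hE _ h1.1
        rwa [mul_div_cancel₀ _ hr] at this
      · rw [← h1.2]
        congr 1
        push_cast
        ring
    · have h1 := (Equiv.divRight₀ r hr).hasSum_iff.2 (hf (B τ))
      refine h1.congr_fun fun e => ?_
      simp only [Function.comp, Equiv.divRight₀_apply, hB, smul_smul, ← Complex.exp_add]
      congr 2
      push_cast
      field_simp
  -- The binomial expansion of `(r τ + b) ^ j`: the translation part only produces lower powers of
  -- `τ`.
  have e1 : LinearMap.funLeft ℂ V B (mulPow V j f) =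
      ∑ i ∈ Finset.range (j + 1), ((r : ℂ) ^ i * (b : ℂ) ^ (j - i) * (j.choose i : ℂ)) •
        mulPow V i (f ∘ B) := by
    funext τ
    simp only [LinearMap.funLeft_apply, mulPow_apply, hB, add_pow, Finset.sum_apply, Pi.smul_apply,
      Finset.sum_smul, Function.comp, smul_smul]
    refine Finset.sum_congr rfl fun i _ => ?_
    congr 1
    ring
  rw [Submodule.mem_comap, e1]
  exact Submodule.sum_mem _ fun i _ => Submodule.smul_mem _ _ (mulPow_mem_logSeries hfB i)

lemma logSeries_clm_comp {h : ℝ} {E : Set ℝ} (L : V →L[ℂ] W) {F : ℍ → V}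
    (hF : F ∈ LogSeries V h E) : (fun τ => L (F τ)) ∈ LogSeries W h E := by
  suffices LogSeries V h E ≤ (LogSeries W h E).comap (L.toLinearMap.compLeft ℍ) from this hF
  refine logSeries_le_iff.2 fun z f hf j => ?_
  obtain ⟨a, ha, hf⟩ := hf
  have h1 : (fun τ => L (f τ)) ∈ QSeries W h E z := by
    refine ⟨fun e => L (a e), fun e he => ha e fun h0 => he (by simp [h0]), fun τ => ?_⟩
    simpa using (hf τ).mapL L
  have h2 := mulPow_mem_logSeries h1 j
  rw [Submodule.mem_comap]
  convert! h2 using 1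
  funext τ
  simp [mulPow_apply]

/-- The vanishing of `f z j` for `z ∉ S` lets the sum over `S` be compared later with a sum over
eigenvalues. -/
lemma exists_sum_of_mem_logSeries {h : ℝ} {E : Set ℝ} {F : ℍ → V} (hF : F ∈ LogSeries V h E) :
    ∃ (S : Finset ℂ) (J : ℕ) (f : ℂ → ℕ → ℍ → V), (∀ z j, f z j ∈ QSeries V h E z) ∧
      (∀ z ∉ S, ∀ j, f z j = 0) ∧ F = ∑ z ∈ S, ∑ j ∈ Finset.range J, mulPow V j (f z j) := by
  classical
  obtain ⟨φ, hφ, rfl⟩ := (Submodule.mem_iSup_iff_exists_finsupp _ _).1 hF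
  choose f hf hf' using fun p => Submodule.mem_map.1 (hφ p)
  refine ⟨φ.support.image Prod.fst, φ.support.sup Prod.snd + 1,
    fun z j => if z ∈ φ.support.image Prod.fst then f (z, j) else 0, fun z j => ?_,
    fun z hz j => if_neg hz, ?_⟩
  · dsimp only
    split_ifs
    · exact hf (z, j)
    · exact Submodule.zero_mem _
  · rw [Finsupp.sum, ← Finset.sum_product']
    rw [Finset.sum_subset (s₁ := φ.support)
      (s₂ := φ.support.image Prod.fst ×ˢ Finset.range (φ.support.sup Prod.snd + 1))]
    · refine Finset.sum_congr rfl fun p hp => ?_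
      dsimp only
      rw [if_pos (Finset.mem_product.1 hp).1]
      exact (hf' p).symm
    · intro p hp
      rw [Finset.mem_product, Finset.mem_range]
      exact ⟨Finset.mem_image_of_mem _ hp, Nat.lt_succ_of_le (Finset.le_sup hp)⟩
    · intro p _ hp
      exact Finsupp.notMem_support_iff.1 hp

/-! ### The shift operator -/

/-- The operator `F ↦ F(· + h)`. -/
def shift (V : Type*) [AddCommGroup V] [Module ℂ V] (h : ℝ) : Module.End ℂ (ℍ → V) :=
  LinearMap.funLeft ℂ V fun τ => translation h • τ

lemma shift_apply (h : ℝ) (F : ℍ → V) (τ : ℍ) : shift V h F τ = F (translation h • τ) := rfl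

lemma shift_of_mem_qSeries {h : ℝ} {E : Set ℝ} {z : ℂ} {f : ℍ → V} (hf : f ∈ QSeries V h E z) :
    shift V h f = z • f := by
  obtain ⟨a, ha, hf⟩ := hf
  funext τ
  rw [shift_apply, Pi.smul_apply]
  refine (hf _).unique ?_
  convert! (hf τ).const_smul z using 2 with e
  rw [coe_translation_smul, mul_add, Complex.exp_add, smul_smul]
  by_cases h0 : a e = 0
  · simp [h0]
  · rw [(ha e h0).2, mul_comm]

lemma eq_zero_of_mem_qSeries_zero {h : ℝ} {E : Set ℝ} {f : ℍ → V} (hf : f ∈ QSeries V h E 0) :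
    f = 0 := by
  obtain ⟨a, ha, hf⟩ := hf
  have : a = 0 := by
    funext e
    by_contra h0
    exact Complex.exp_ne_zero _ (ha e h0).2
  funext τ
  refine (hf τ).unique ?_
  simp [this]

/-- On a multiple of an eigenfunction for `z`, the operator `shift - z` acts as `z` times the
forward difference of the scalar factor. The degree in `τ` can thus be read off from finite
differences. -/
lemma shift_sub_pow {h : ℝ} {z : ℂ} {f : ℍ → V} (hf : shift V h f = z • f) (n : ℕ)
    (g : ℂ → ℂ) :
    ((shift V h - z • 1) ^ n) (fun τ : ℍ => g τ • f τ) =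
      fun τ : ℍ => z ^ n • ((fwdDiff (h : ℂ))^[n] g) τ • f τ := by
  induction n generalizing g with
  | zero => simp
  | succ n ih =>
    have h1 : (shift V h - z • 1) (fun τ : ℍ => g τ • f τ) =
        z • fun τ : ℍ => (fwdDiff (h : ℂ) g) τ • f τ := by
      funext τ
      have h2 := congrFun hf τ
      rw [shift_apply, Pi.smul_apply] at h2
      simp only [LinearMap.sub_apply, LinearMap.smul_apply, Module.End.one_apply, Pi.sub_apply,
        Pi.smul_apply, shift_apply, coe_translation_smul, h2, fwdDiff, sub_smul, smul_sub]
      rw [smul_comm z, smul_comm z]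
    rw [pow_succ, Module.End.mul_apply, h1, map_smul, ih, Function.iterate_succ_apply]
    funext τ
    rw [Pi.smul_apply, smul_smul, pow_succ, mul_comm z]

lemma fwdDiff_iter_comp_div {h : ℂ} (hh : h ≠ 0) (n : ℕ) (p : ℂ → ℂ) :
    (fwdDiff h)^[n] (fun x => p (x / h)) = fun x => ((fwdDiff (1 : ℂ))^[n] p) (x / h) := by
  induction n generalizing p with
  | zero => rfl
  | succ n ih =>
    rw [Function.iterate_succ_apply, Function.iterate_succ_apply, ← ih]
    congr 1
    funext x
    simp [fwdDiff, add_div, div_self hh]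

lemma mulPow_eq_smul {h : ℝ} (hh : h ≠ 0) (j : ℕ) (f : ℍ → V) :
    mulPow V j f = (h : ℂ) ^ j • fun τ : ℍ => ((τ : ℂ) / h) ^ j • f τ := by
  have hhc : (h : ℂ) ≠ 0 := by exact_mod_cast hh
  funext τ
  rw [mulPow_apply, Pi.smul_apply, smul_smul, ← mul_pow, mul_div_cancel₀ _ hhc]

lemma shift_sub_pow_mulPow_of_lt {h : ℝ} (hh : h ≠ 0) {z : ℂ} {f : ℍ → V}
    (hf : shift V h f = z • f) {j n : ℕ} (hjn : j < n) :
    ((shift V h - z • 1) ^ n) (mulPow V j f) = 0 := by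
  have hhc : (h : ℂ) ≠ 0 := by exact_mod_cast hh
  have key : ((shift V h - z • 1) ^ n) (fun τ : ℍ => ((τ : ℂ) / h) ^ j • f τ) = _ :=
    shift_sub_pow hf n fun x => (x / h) ^ j
  rw [mulPow_eq_smul hh, map_smul, key, fwdDiff_iter_comp_div hhc n (fun x => x ^ j),
    fwdDiff_iter_pow_eq_zero_of_lt hjn]
  funext τ
  simp

lemma shift_sub_pow_mulPow_self {h : ℝ} (hh : h ≠ 0) {z : ℂ} {f : ℍ → V}
    (hf : shift V h f = z • f) (n : ℕ) :
    ((shift V h - z • 1) ^ n) (mulPow V n f) = ((h : ℂ) ^ n * z ^ n * n.factorial) • f := by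
  have hhc : (h : ℂ) ≠ 0 := by exact_mod_cast hh
  have key : ((shift V h - z • 1) ^ n) (fun τ : ℍ => ((τ : ℂ) / h) ^ n • f τ) = _ :=
    shift_sub_pow hf n fun x => (x / h) ^ n
  rw [mulPow_eq_smul hh, map_smul, key, fwdDiff_iter_comp_div hhc n (fun x => x ^ n),
    fwdDiff_iter_eq_factorial]
  funext τ
  simp [mul_smul]

lemma sum_mulPow_mem_maxGenEigenspace {h : ℝ} (hh : h ≠ 0) {z : ℂ} {f : ℕ → ℍ → V}
    (hf : ∀ j, shift V h (f j) = z • f j) (J : ℕ) :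
    ∑ j ∈ Finset.range J, mulPow V j (f j) ∈ (shift V h).maxGenEigenspace z := by
  refine (Module.End.mem_maxGenEigenspace _ _ _).2 ⟨J, ?_⟩
  rw [map_sum]
  exact Finset.sum_eq_zero fun j hj =>
    shift_sub_pow_mulPow_of_lt hh (hf j) (Finset.mem_range.1 hj)

/-- The logarithmic degree is bounded by the order of nilpotency of the shift. -/
lemma eq_zero_of_shift_sub_pow_eq_zero {h : ℝ} (hh : h ≠ 0) {z : ℂ} (hz : z ≠ 0)
    {f : ℕ → ℍ → V} (hf : ∀ j, shift V h (f j) = z • f j) {m : ℕ} (J : ℕ)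
    (h0 : ((shift V h - z • 1) ^ m) (∑ j ∈ Finset.range J, mulPow V j (f j)) = 0) :
    ∀ j < J, m ≤ j → f j = 0 := by
  have hhc : (h : ℂ) ≠ 0 := by exact_mod_cast hh
  induction J with
  | zero => intro j hj; omega
  | succ J ih =>
    intro j hj hmj
    -- The top coefficient is isolated by applying the `J`-th power, `J ≥ m`: it kills all lower
    -- terms and turns the top one into `h ^ J z ^ J J! • f J`. Once it is gone, induction handles
    -- the rest.
    have hJ : f J = 0 := by
      have h1 : ((shift V h - z • 1) ^ J)
          (∑ j ∈ Finset.range (J + 1), mulPow V j (f j)) = 0 := by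
        obtain ⟨i, rfl⟩ := Nat.exists_eq_add_of_le (hmj.trans (Nat.lt_succ_iff.1 hj))
        rw [add_comm m i, pow_add, Module.End.mul_apply, add_comm i m, h0, map_zero]
      rw [Finset.sum_range_succ, map_add, map_sum, Finset.sum_eq_zero fun j hj =>
        shift_sub_pow_mulPow_of_lt hh (hf j) (Finset.mem_range.1 hj), zero_add,
        shift_sub_pow_mulPow_self hh (hf J)] at h1
      refine (smul_eq_zero.1 h1).resolve_left ?_
      have : (J.factorial : ℂ) ≠ 0 := by exact_mod_cast J.factorial_ne_zero
      exact mul_ne_zero (mul_ne_zero (pow_ne_zero _ hhc) (pow_ne_zero _ hz)) this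
    rcases (Nat.lt_succ_iff_lt_or_eq.1 hj) with hlt | rfl
    · refine ih ?_ j hlt hmj
      rw [Finset.sum_range_succ, hJ, map_zero, add_zero] at h0
      exact h0
    · exact hJ

end LogSeries

/-! ### Logarithmic series that transform under a matrix -/

section Matrix

variable {ι : Type*} [Fintype ι] [DecidableEq ι]

lemma compLeft_sub_pow_apply (T : Matrix ι ι ℂ) (z : ℂ) (n : ℕ) (F : ℍ → ι → ℂ) (τ : ℍ) :
    (((Matrix.toLin' T).compLeft ℍ - z • 1) ^ n) F τ =
      ((Matrix.toLin' T - z • 1) ^ n) (F τ) := by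
  induction n generalizing F with
  | zero => rfl
  | succ n ih =>
    rw [pow_succ, Module.End.mul_apply, ih, pow_succ, Module.End.mul_apply]
    rfl

/-- A logarithmic series `F` with `F(τ + h) = T F(τ)` only involves the eigenvalues of `T`, with
logarithmic degrees bounded by the block sizes. -/
lemma exists_sum_of_shift_eq {h : ℝ} (hh : h ≠ 0) {E : Set ℝ} {T : Matrix ι ι ℂ}
    {F : ℍ → ι → ℂ} (hF : F ∈ LogSeries (ι → ℂ) h E)
    (hT : ∀ τ : ℍ, F (translation h • τ) = T.mulVec (F τ)) :
    ∃ f : ℂ → ℕ → ℍ → ι → ℂ, (∀ z j, f z j ∈ QSeries (ι → ℂ) h E z) ∧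
      F = ∑ z ∈ T.charpoly.roots.toFinset, ∑ j ∈ Finset.range (blockSize T z),
        mulPow (ι → ℂ) j (f z j) := by
  classical
  obtain ⟨S, J, f, hf, hfS, hsum⟩ := exists_sum_of_mem_logSeries hF
  set U := shift (ι → ℂ) h
  set A : Module.End ℂ (ℍ → ι → ℂ) := (Matrix.toLin' T).compLeft ℍ
  have hcomm : Commute U A := by
    ext F τ
    rfl
  have hUA : U F = A F := by
    funext τ
    exact (hT τ).trans (Matrix.toLin'_apply _ _).symm
  set Fz : ℂ → ℍ → ι → ℂ := fun z => ∑ j ∈ Finset.range J, mulPow (ι → ℂ) j (f z j)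
  have hshift : ∀ z j, U (f z j) = z • f z j := fun z j => shift_of_mem_qSeries (hf z j)
  have hFz : ∀ z, Fz z ∈ U.maxGenEigenspace z := fun z =>
    sum_mulPow_mem_maxGenEigenspace hh (hshift z) J
  -- Because `A` commutes with the shift `U`, each `U (Fz z) - A (Fz z)` stays in the generalized
  -- eigenspace of `U` for `z`. These differences sum to `U F - A F = 0`, so independence makes each
  -- of them vanish.
  have hUFz : ∀ z, U (Fz z) = A (Fz z) := by
    have hind := (iSupIndep_iff_finsetSum_eq_zero_imp_eq_zero _).1
      U.independent_maxGenEigenspace S (fun z => U (Fz z) - A (Fz z))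
      (fun z _ => Submodule.sub_mem _
        (Module.End.mapsTo_maxGenEigenspace_of_comm (Commute.refl U) z (hFz z))
        (Module.End.mapsTo_maxGenEigenspace_of_comm hcomm z (hFz z)))
      (by rw [Finset.sum_sub_distrib, ← map_sum, ← map_sum, ← hsum, hUA, sub_self])
    intro z
    by_cases hz : z ∈ S
    · exact sub_eq_zero.1 (hind z hz)
    · have : Fz z = 0 := Finset.sum_eq_zero fun j _ => by rw [hfS z hz j, map_zero]
      rw [this, map_zero, map_zero]
  -- `U` and `A` agree only at `Fz z` itself, so commutation is needed to move one factor at a time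
  -- onto it.
  have hpow : ∀ (z : ℂ) (n : ℕ), ((U - z • 1) ^ n) (Fz z) = ((A - z • 1) ^ n) (Fz z) := by
    intro z n
    induction n with
    | zero => rfl
    | succ n ih =>
      have h1 : Commute ((A - z • 1) ^ n) (U - z • 1) := by
        refine Commute.pow_left ?_ n
        refine Commute.sub_left (Commute.sub_right hcomm.symm ?_) ?_
        · exact (Commute.one_right _).smul_right z
        · exact (Commute.one_left _).smul_left z
      rw [pow_succ', Module.End.mul_apply, ih, ← Module.End.mul_apply, ← h1.eq,
        Module.End.mul_apply, pow_succ, Module.End.mul_apply]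
      simp only [LinearMap.sub_apply, hUFz z]
  have hmem : ∀ z τ, Fz z τ ∈ Module.End.maxGenEigenspace (Matrix.toLin' T) z := by
    intro z τ
    obtain ⟨n, hn⟩ := (Module.End.mem_maxGenEigenspace _ _ _).1 (hFz z)
    refine (Module.End.mem_maxGenEigenspace _ _ _).2 ⟨n, ?_⟩
    rw [← compLeft_sub_pow_apply, ← hpow, hn]
    rfl
  have hkill : ∀ z, ((U - z • 1) ^ blockSize T z) (Fz z) = 0 := by
    intro z
    rw [hpow]
    funext τ
    rw [compLeft_sub_pow_apply]
    have := hmem z τ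
    rw [Module.End.maxGenEigenspace_eq, Module.End.mem_genEigenspace_nat] at this
    exact this
  have hdeg : ∀ z, ∀ j < J, blockSize T z ≤ j → f z j = 0 := by
    intro z j hj hbj
    -- The factor `z ^ J` in the top coefficient requires `z ≠ 0`. The label `0` carries no series
    -- at all, as the exponential never vanishes.
    by_cases hz : z = 0
    · subst hz
      exact eq_zero_of_mem_qSeries_zero (hf 0 j)
    · exact eq_zero_of_shift_sub_pow_eq_zero hh hz (hshift z) J (hkill z) j hj hbj
  have hroot : ∀ z, z ∉ T.charpoly.roots → Fz z = 0 := by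
    intro z hz
    funext τ
    have hm := hmem z τ
    rw [mem_roots_charpoly_iff] at hz
    push Not at hz
    obtain ⟨n, hn⟩ := (Module.End.mem_maxGenEigenspace _ _ _).1 hm
    have hinj : Function.Injective (Matrix.toLin' T - z • (1 : Module.End ℂ (ι → ℂ))) := by
      rw [← LinearMap.ker_eq_bot, LinearMap.ker_eq_bot']
      intro v hv
      by_contra hv0
      refine hz v hv0 ?_
      simpa [sub_eq_zero] using hv
    have hinj' : Function.Injective ((Matrix.toLin' T - z • (1 : Module.End ℂ (ι → ℂ))) ^ n) := by
      rw [Module.End.coe_pow]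
      exact hinj.iterate n
    exact hinj' (hn.trans (map_zero _).symm)
  refine ⟨fun z j => if j < J then f z j else 0, fun z j => ?_, ?_⟩
  · dsimp only
    split_ifs
    · exact hf z j
    · exact Submodule.zero_mem _
  · have hinner : ∀ z, ∑ j ∈ Finset.range (blockSize T z),
        mulPow (ι → ℂ) j (if j < J then f z j else 0) = Fz z := by
      intro z
      have e1 : Fz z = ∑ j ∈ Finset.range J, mulPow (ι → ℂ) j (if j < J then f z j else 0) :=
        Finset.sum_congr rfl fun j hj => by rw [if_pos (Finset.mem_range.1 hj)]
      rw [e1, Finset.sum_subset (Finset.range_subset_range.2 (le_max_left (blockSize T z) J)),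
        ← Finset.sum_subset (Finset.range_subset_range.2 (le_max_right (blockSize T z) J))]
      · intro j _ hj
        rw [if_neg (by simpa using hj), map_zero]
      · intro j _ hj
        split_ifs with hjJ
        · rw [hdeg z j hjJ (by simpa using hj), map_zero]
        · rw [map_zero]
    simp only [hinner]
    rw [hsum]
    rw [Finset.sum_subset (Finset.subset_union_left (s₂ := T.charpoly.roots.toFinset)),
      ← Finset.sum_subset (Finset.subset_union_right (s₁ := S))]
    · intro z _ hz
      exact hroot z fun h => hz (Multiset.mem_toFinset.2 h)
    · intro z _ hz
      exact Finset.sum_eq_zero fun j _ => by rw [hfS z hz j, map_zero]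

end Matrix

/-! ### Comparison with logarithmic expansions -/

lemma mu_exp (x : ℝ) : mu (Complex.exp (2 * Real.pi * Complex.I * x)) = Int.fract x := by
  have e : Complex.exp (2 * Real.pi * Complex.I * x) =
      Complex.exp ((2 * Real.pi * x : ℝ) * Complex.I) := by
    congr 1
    push_cast
    ring
  rw [mu, e, Complex.arg_exp_mul_I, toIocMod]
  have : (2 * Real.pi * x - toIocDiv Real.two_pi_pos (-Real.pi) (2 * Real.pi * x) • (2 * Real.pi)) /
      (2 * Real.pi) = x - (toIocDiv Real.two_pi_pos (-Real.pi) (2 * Real.pi * x) : ℤ) := by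
    have := Real.pi_pos
    rw [zsmul_eq_mul]
    field_simp
  rw [this, Int.fract_sub_intCast]

/-- A family of sets of exponents, each of which may bound the exponents of a form at a cusp. -/
structure IsExponentFamily (𝓔 : Set (Set ℝ)) : Prop where
  scale : ∀ E ∈ 𝓔, ∀ r : ℝ, 0 < r → ∃ E' ∈ 𝓔, ∀ e ∈ E, r * e ∈ E'
  directed : DirectedOn (· ⊆ ·) 𝓔
  nonempty : 𝓔.Nonempty

/-- The condition `P` on coefficients says that the exponents (with respect to `exp (2 π i τ)`)
of the nonzero terms lie in some member of `𝓔`. -/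
def IsExponentCondition {ι : Type*} [Fintype ι] [DecidableEq ι] (𝓔 : Set (Set ℝ))
    (P : Matrix ι ι ℂ → (ℂ → ℕ → ℤ → ι → ℂ) → Prop) : Prop :=
  ∀ T (h : ℝ), 0 < h → ∀ a, P T a ↔ ∃ E ∈ 𝓔, ∀ z ∈ T.charpoly.roots, ∀ j < blockSize T z,
    ∀ n : ℤ, a z j n ≠ 0 → (mu z + n) / h ∈ E

lemma isExponentFamily_range_Ici : IsExponentFamily (Set.range Set.Ici) where
  scale := by
    rintro _ ⟨M, rfl⟩ r hr
    exact ⟨_, ⟨r * M, rfl⟩, fun e he => mul_le_mul_of_nonneg_left he hr.le⟩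
  directed := by
    rintro _ ⟨M, rfl⟩ _ ⟨M', rfl⟩
    exact ⟨_, ⟨min M M', rfl⟩, Set.Ici_subset_Ici.2 (min_le_left _ _),
      Set.Ici_subset_Ici.2 (min_le_right _ _)⟩
  nonempty := ⟨_, 0, rfl⟩

lemma isExponentFamily_Ici : IsExponentFamily {Set.Ici 0} where
  scale := by
    rintro _ rfl r hr
    exact ⟨_, rfl, fun e he => mul_nonneg hr.le he⟩
  directed := by
    rintro _ rfl _ rfl
    exact ⟨_, rfl, subset_rfl, subset_rfl⟩
  nonempty := ⟨_, rfl⟩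

lemma isExponentFamily_Ioi : IsExponentFamily {Set.Ioi 0} where
  scale := by
    rintro _ rfl r hr
    exact ⟨_, rfl, fun e he => mul_pos hr he⟩
  directed := by
    rintro _ rfl _ rfl
    exact ⟨_, rfl, subset_rfl, subset_rfl⟩
  nonempty := ⟨_, rfl⟩

section Expansion

variable {ι : Type*} [Fintype ι] [DecidableEq ι]

lemma isExponentCondition_meromorphic :
    IsExponentCondition (ι := ι) (Set.range Set.Ici) MeromorphicCoeffs := by
  intro T h hh a
  constructor
  · rintro ⟨M, hM⟩
    refine ⟨_, ⟨M / h, rfl⟩, fun z hz j hj n hn => ?_⟩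
    have h1 : M ≤ n := not_lt.1 fun h0 => hn (hM z hz j hj n h0)
    have h2 : (M : ℝ) ≤ n := by exact_mod_cast h1
    have h3 : 0 ≤ mu z := Int.fract_nonneg _
    exact div_le_div_of_nonneg_right (by linarith) hh.le
  · rintro ⟨_, ⟨M, rfl⟩, hM⟩
    -- From `M h ≤ μ + n < n + 1` one gets only `⌈M h⌉ ≤ n + 1`, hence the shift by one.
    refine ⟨⌈M * h⌉ - 1, fun z hz j hj n hn => ?_⟩
    by_contra h0
    have h1 : M ≤ (mu z + n) / h := hM z hz j hj n h0
    rw [le_div_iff₀ hh] at h1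
    have h2 : mu z < 1 := Int.fract_lt_one _
    have h3 : M * h ≤ ((n + 1 : ℤ) : ℝ) := by push_cast; linarith
    have h4 := Int.ceil_le.2 h3
    omega

lemma isExponentCondition_holomorphic :
    IsExponentCondition (ι := ι) {Set.Ici 0} HolomorphicCoeffs := by
  intro T h hh a
  simp only [Set.mem_singleton_iff, exists_eq_left, HolomorphicCoeffs]
  refine forall₄_congr fun z hz j hj => forall_congr' fun n => ?_
  rw [← not_imp_not, Set.mem_Ici, le_div_iff₀ hh, zero_mul]
  refine imp_congr Iff.rfl ?_
  have h2 : mu z < 1 := Int.fract_lt_one _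
  have h3 : 0 ≤ mu z := Int.fract_nonneg _
  rw [not_lt]
  constructor
  · intro h0
    have : (0 : ℝ) ≤ n := by exact_mod_cast h0
    linarith
  · intro h0
    have : (-1 : ℝ) < n := by linarith
    have : (-1 : ℤ) < n := by exact_mod_cast this
    omega

lemma isExponentCondition_cuspidal :
    IsExponentCondition (ι := ι) {Set.Ioi 0} CuspidalCoeffs := by
  intro T h hh a
  simp only [Set.mem_singleton_iff, exists_eq_left, CuspidalCoeffs]
  refine forall₄_congr fun z hz j hj => forall_congr' fun n => ?_
  rw [← not_imp_not, Set.mem_Ioi, div_pos_iff_of_pos_right hh, not_le]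

/-- The integer-indexed series is re-indexed by the real exponents `(μ(z) + n) / h`, with
coefficient zero elsewhere. The label used is `exp (2 π i μ(z))`; `LogSeries` admits every label, so
comparing it with `z` is not needed. -/
lemma mem_logSeries_of_isLogExpansion {𝓔 : Set (Set ℝ)}
    {P : Matrix ι ι ℂ → (ℂ → ℕ → ℤ → ι → ℂ) → Prop} (hP : IsExponentCondition 𝓔 P)
    {T : Matrix ι ι ℂ} {h : ℝ} (hh : 0 < h) {F : ℍ → ι → ℂ} {a : ℂ → ℕ → ℤ → ι → ℂ}
    (hF : IsLogExpansion T h F a) (ha : P T a) : ∃ E ∈ 𝓔, F ∈ LogSeries (ι → ℂ) h E := by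
  obtain ⟨E, hE, haE⟩ := (hP T h hh a).1 ha
  obtain ⟨H, hH, hFH⟩ := hF
  have hhc : (h : ℂ) ≠ 0 := by exact_mod_cast hh.ne'
  refine ⟨E, hE, ?_⟩
  have e : F = ∑ z ∈ T.charpoly.roots.toFinset, ∑ j ∈ Finset.range (blockSize T z),
      (2 * Real.pi * Complex.I / h) ^ j • mulPow (ι → ℂ) j (H z j) := by
    funext τ
    rw [hFH τ]
    simp only [Finset.sum_apply, Pi.smul_apply, mulPow_apply, smul_smul, ← mul_pow]
    refine Finset.sum_congr rfl fun z _ => Finset.sum_congr rfl fun j _ => ?_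
    rw [mul_div_right_comm]
  rw [e]
  refine Submodule.sum_mem _ fun z hz => Submodule.sum_mem _ fun j hj =>
    Submodule.smul_mem _ _ ?_
  rw [Multiset.mem_toFinset] at hz
  rw [Finset.mem_range] at hj
  have hinj : Function.Injective fun n : ℤ => (mu z + n) / h := by
    intro n n' hn
    simp only at hn
    rw [div_left_inj' hh.ne', add_right_inj] at hn
    exact_mod_cast hn
  refine mulPow_mem_logSeries (z := Complex.exp (2 * Real.pi * Complex.I * mu z))
    ⟨Function.extend (fun n : ℤ => (mu z + n) / h) (a z j) 0, fun e he => ?_, fun τ => ?_⟩ j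
  · by_cases hex : ∃ n : ℤ, (mu z + n) / h = e
    · obtain ⟨n, rfl⟩ := hex
      rw [hinj.extend_apply] at he
      refine ⟨haE z hz j hj n he, Complex.exp_eq_exp_iff_exists_int.2 ⟨n, ?_⟩⟩
      push_cast
      field_simp
    · rw [Function.extend_apply' _ _ _ hex] at he
      exact (he rfl).elim
  · refine (hinj.hasSum_iff fun e he => ?_).1 ((hH z hz j hj τ).congr_fun fun n => ?_)
    · rw [Function.extend_apply' _ _ _ he]
      simp
    · simp only [Function.comp, hinj.extend_apply]
      congr 2
      push_cast
      field_simp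

/-- The transformation law under `T` restores what `LogSeries` forgets: which eigenvalues occur and
how many logarithms each of them allows. -/
lemma exists_isLogExpansion_of_mem_logSeries {𝓔 : Set (Set ℝ)}
    {P : Matrix ι ι ℂ → (ℂ → ℕ → ℤ → ι → ℂ) → Prop} (hP : IsExponentCondition 𝓔 P)
    {T : Matrix ι ι ℂ} {h : ℝ} (hh : 0 < h) {F : ℍ → ι → ℂ}
    (hT : ∀ τ : ℍ, F (translation h • τ) = T.mulVec (F τ)) {E : Set ℝ} (hE : E ∈ 𝓔)
    (hF : F ∈ LogSeries (ι → ℂ) h E) : ∃ a, IsLogExpansion T h F a ∧ P T a := by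
  obtain ⟨f, hf, hsum⟩ := exists_sum_of_shift_eq hh.ne' hF hT
  choose b hb hbf using hf
  have hhc : (h : ℂ) ≠ 0 := by exact_mod_cast hh.ne'
  have hpi : (2 * Real.pi * Complex.I / h : ℂ) ≠ 0 :=
    div_ne_zero Complex.two_pi_I_ne_zero hhc
  -- The factor `(2 π i / h) ^ (-j)` converts `τ ^ j` into `(log q) ^ j`.
  refine ⟨fun z j n => ((2 * Real.pi * Complex.I / h) ^ j)⁻¹ • b z j ((mu z + n) / h),
    ⟨fun z j => ((2 * Real.pi * Complex.I / h : ℂ) ^ j)⁻¹ • f z j, fun z hz j hj τ => ?_,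
      fun τ => ?_⟩, (hP T h hh _).2 ⟨E, hE, fun z hz j hj n hn => ?_⟩⟩
  · have hinj : Function.Injective fun n : ℤ => (mu z + n) / h := by
      intro n n' hn
      simp only at hn
      rw [div_left_inj' hh.ne', add_right_inj] at hn
      exact_mod_cast hn
    have h1 := (hinj.hasSum_iff fun e he => by
      by_cases h0 : b z j e = 0
      · simp [h0]
      -- An exponent with `exp (2 π i e h) = z` satisfies `μ(z) = Int.fract (e * h)`, so it has the
      -- form `(μ(z) + n) / h` with `n = ⌊e * h⌋`.
      · refine (he ⟨⌊e * h⌋, ?_⟩).elim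
        have h2 := (hb z j e h0).2
        have h3 : mu z = Int.fract (e * h) := by
          rw [← h2, ← mu_exp]
          congr 2
          push_cast
          ring
        simp only
        rw [h3, Int.fract_add_floor, mul_div_cancel_right₀ _ hh.ne']).2 (hbf z j τ)
    refine (h1.const_smul ((2 * Real.pi * Complex.I / h : ℂ) ^ j)⁻¹).congr_fun fun n => ?_
    simp only [Function.comp]
    rw [smul_comm]
    congr 3
    push_cast
    field_simp
  · rw [hsum]
    simp only [Finset.sum_apply, Pi.smul_apply, mulPow_apply, smul_smul]
    refine Finset.sum_congr rfl fun z _ => Finset.sum_congr rfl fun j _ => ?_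
    congr 1
    rw [mul_div_right_comm, mul_pow]
    field_simp
  · exact (hb z j _ fun h0 => hn (by simp [h0])).1

end Expansion

/-! ### Cusps and their widths -/

lemma translation_add (x y : ℝ) : translation (x + y) = translation x * translation y := by
  apply Subtype.ext
  change !![1, x + y; 0, 1] = !![1, x; 0, 1] * !![1, y; 0, 1]
  simp [add_comm]

lemma cuspTranslation_add (c : OnePoint ℝ) (x y : ℝ) :
    cuspTranslation c (x + y) = cuspTranslation c x * cuspTranslation c y := by
  simp only [cuspTranslation, translation_add]
  group

lemma cuspTranslation_zero (c : OnePoint ℝ) : cuspTranslation c 0 = 1 := by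
  have := cuspTranslation_add c 0 0
  simpa using this

/-- The group of `x` with `A_c t ^ x A_c⁻¹ ∈ Γ`. -/
def widthGroup (Γ : Subgroup SL(2, ℝ)) (c : OnePoint ℝ) : AddSubgroup ℝ where
  carrier := {x | cuspTranslation c x ∈ Γ}
  zero_mem' := by
    rw [Set.mem_ofPred_eq, cuspTranslation_zero]
    exact Γ.one_mem
  add_mem' {x y} hx hy := by
    rw [Set.mem_ofPred_eq, cuspTranslation_add]
    exact Γ.mul_mem hx hy
  neg_mem' {x} hx := by
    have : cuspTranslation c (-x) = (cuspTranslation c x)⁻¹ := by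
      rw [eq_inv_iff_mul_eq_one, ← cuspTranslation_add, neg_add_cancel, cuspTranslation_zero]
    rw [Set.mem_ofPred_eq, this]
    exact Γ.inv_mem hx

lemma mem_widthGroup {Γ : Subgroup SL(2, ℝ)} {c : OnePoint ℝ} {x : ℝ} :
    x ∈ widthGroup Γ c ↔ cuspTranslation c x ∈ Γ := Iff.rfl

lemma cuspTranslation_nsmul (c : OnePoint ℝ) (n : ℕ) (x : ℝ) :
    cuspTranslation c (n • x) = cuspTranslation c x ^ n := by
  induction n with
  | zero => simp [cuspTranslation_zero]
  | succ n ih => rw [succ_nsmul, cuspTranslation_add, ih, pow_succ]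

/-- Transfers existence of a cusp width from one group to the other, together with commensurability
of the two widths. `B` is generated by `b`, so each positive element of `A` is `n b / D` with a
positive integer `n`, and the smallest such `n` gives the minimum. -/
lemma exists_isLeast_of_nsmul_mem {A B : AddSubgroup ℝ} {D : ℕ} (hD : 0 < D)
    (hAB : ∀ x ∈ A, D • x ∈ B) {b : ℝ} (hb : IsLeast {x | 0 < x ∧ x ∈ B} b)
    (hA : ∃ x ∈ A, 0 < x) :
    ∃ (a : ℝ) (n : ℕ), IsLeast {x | 0 < x ∧ x ∈ A} a ∧ 0 < n ∧ D * a = n * b := by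
  classical
  have hcyc : B = AddSubgroup.closure {b} := AddSubgroup.cyclic_of_min (by
    simpa only [and_comm] using hb)
  have hb0 : 0 < b := hb.1.1
  have hDr : (0 : ℝ) < D := by exact_mod_cast hD
  have key : ∀ x ∈ A, 0 < x → ∃ n : ℕ, 0 < n ∧ D * x = n * b := by
    intro x hx hx0
    have h1 := hAB x hx
    rw [hcyc, AddSubgroup.mem_closure_singleton] at h1
    obtain ⟨m, hm⟩ := h1
    rw [zsmul_eq_mul, nsmul_eq_mul] at hm
    have hm0 : 0 < m := by
      have : (0 : ℝ) < m * b := by rw [hm]; positivity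
      exact_mod_cast (pos_iff_pos_of_mul_pos this).2 hb0
    refine ⟨m.toNat, by omega, ?_⟩
    rw [← hm]
    congr 1
    exact_mod_cast (Int.toNat_of_nonneg hm0.le).symm
  have hex : ∃ n : ℕ, 0 < n ∧ ∃ x ∈ A, D * x = n * b := by
    obtain ⟨x, hx, hx0⟩ := hA
    obtain ⟨n, hn, h⟩ := key x hx hx0
    exact ⟨n, hn, x, hx, h⟩
  obtain ⟨hn, x, hx, h⟩ := Nat.find_spec hex
  have hx0 : 0 < x := by
    have : 0 < (D : ℝ) * x := by
      rw [h]
      exact mul_pos (by exact_mod_cast hn) hb0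
    exact (mul_pos_iff_of_pos_left hDr).1 this
  refine ⟨x, Nat.find hex, ⟨⟨hx0, hx⟩, fun y ⟨hy0, hy⟩ => ?_⟩, hn, h⟩
  obtain ⟨m, hm, hy'⟩ := key y hy hy0
  have h1 : (Nat.find hex : ℝ) ≤ m := by exact_mod_cast Nat.find_min' hex ⟨hm, y, hy, hy'⟩
  have h2 : (D : ℝ) * x ≤ D * y := by
    rw [h, hy']
    exact mul_le_mul_of_nonneg_right h1 hb0.le
  exact le_of_mul_le_mul_left h2 hDr

/-! ### Moving a cusp by a group element -/

/-- The matrix `(a, b; 0, a⁻¹)`. -/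
def upperTriangular (a b : ℝ) (ha : a ≠ 0) : SL(2, ℝ) :=
  ⟨!![a, b; 0, a⁻¹], by simp [Matrix.det_fin_two, ha]⟩

lemma coe_upperTriangular_smul {a b : ℝ} (ha : a ≠ 0) (τ : ℍ) :
    ((upperTriangular a b ha • τ : ℍ) : ℂ) = (a ^ 2 : ℝ) * τ + (a * b : ℝ) := by
  have hac : (a : ℂ) ≠ 0 := by exact_mod_cast ha
  rw [UpperHalfPlane.specialLinearGroup_apply]
  simp [upperTriangular]
  field_simp

lemma stroke_upperTriangular {V : Type*} [SMul ℂ V] (k : ℤ) {a b : ℝ} (ha : a ≠ 0) (F : ℍ → V) :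
    stroke k (upperTriangular a b ha) F =
      ((a : ℂ)⁻¹ ^ (-k)) • (F ∘ fun τ => upperTriangular a b ha • τ) := by
  funext τ
  simp [stroke, jFactor, upperTriangular]

lemma stroke_translation {V : Type*} [AddCommGroup V] [Module ℂ V] (k : ℤ) (h : ℝ) (F : ℍ → V)
    (τ : ℍ) : stroke k (translation h) F τ = F (translation h • τ) := by
  simp [stroke, jFactor, translation]

lemma upperTriangular_mul_translation {a b : ℝ} (ha : a ≠ 0) (x : ℝ) :
    upperTriangular a b ha * translation x =
      translation (a ^ 2 * x) * upperTriangular a b ha := by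
  apply Subtype.ext
  change !![a, b; 0, a⁻¹] * !![1, x; 0, 1] = !![1, a ^ 2 * x; 0, 1] * !![a, b; 0, a⁻¹]
  have h : a * x + b = b + a ^ 2 * x * a⁻¹ := by
    field_simp
    ring
  simp [h]

lemma cuspMatrix_smul_infty (c : OnePoint ℝ) :
    Matrix.SpecialLinearGroup.toGL (cuspMatrix c) • (OnePoint.infty : OnePoint ℝ) = c := by
  rw [OnePoint.smul_infty_eq_ite]
  cases c with
  | infty =>
    have : cuspMatrix OnePoint.infty = 1 := rfl
    simp [this]
  | coe x =>
    have h0 : Matrix.SpecialLinearGroup.toGL (cuspMatrix (x : OnePoint ℝ)) 0 0 = x := rfl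
    have h1 : Matrix.SpecialLinearGroup.toGL (cuspMatrix (x : OnePoint ℝ)) 1 0 = 1 := rfl
    simp [h0, h1]

/-- The matrix `A_{gc}⁻¹ g A_c` fixes `∞`, so its lower left entry is zero. -/
lemma exists_upperTriangular (g : SL(2, ℝ)) (c : OnePoint ℝ) :
    ∃ (a b : ℝ) (ha : a ≠ 0), g * cuspMatrix c =
      cuspMatrix (Matrix.SpecialLinearGroup.toGL g • c) * upperTriangular a b ha := by
  set c' := Matrix.SpecialLinearGroup.toGL g • c with hc'
  set B : SL(2, ℝ) := (cuspMatrix c')⁻¹ * g * cuspMatrix c with hB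
  have h10 : B 1 0 = 0 := by
    have h1 : Matrix.SpecialLinearGroup.toGL B • (OnePoint.infty : OnePoint ℝ) =
        OnePoint.infty := by
      rw [hB, map_mul, map_mul, map_inv, mul_smul, mul_smul, cuspMatrix_smul_infty, ← hc',
        inv_smul_eq_iff, cuspMatrix_smul_infty]
    exact OnePoint.smul_infty_eq_self_iff.1 h1
  have hdet := B.det_coe
  rw [Matrix.det_fin_two, h10, mul_zero, sub_zero] at hdet
  have ha : B 0 0 ≠ 0 := fun h => by simp [h] at hdet
  refine ⟨B 0 0, B 0 1, ha, ?_⟩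
  have hBu : upperTriangular (B 0 0) (B 0 1) ha = B := by
    ext i j
    fin_cases i <;> fin_cases j <;> simp [upperTriangular, h10]
    exact inv_eq_of_mul_eq_one_right hdet
  rw [hBu, hB]
  group

/-- Conjugating a translation by `(a, b; 0, a⁻¹)` multiplies its length by `a ^ 2`; hence widths
scale by the same factor. -/
lemma cuspTranslation_smul {g : SL(2, ℝ)} {c c' : OnePoint ℝ} {a b : ℝ} {ha : a ≠ 0}
    (h : g * cuspMatrix c = cuspMatrix c' * upperTriangular a b ha) (x : ℝ) :
    cuspTranslation c' (a ^ 2 * x) = g * cuspTranslation c x * g⁻¹ := by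
  have e1 : cuspMatrix c' = g * cuspMatrix c * (upperTriangular a b ha)⁻¹ := by rw [h]; group
  have e2 : translation (a ^ 2 * x) =
      upperTriangular a b ha * translation x * (upperTriangular a b ha)⁻¹ := by
    rw [upperTriangular_mul_translation]
    group
  rw [cuspTranslation, e1, e2, cuspTranslation]
  group

lemma IsCuspWidth.smul {Γ : Subgroup SL(2, ℝ)} {g : SL(2, ℝ)} (hg : g ∈ Γ) {c c' : OnePoint ℝ}
    {a b : ℝ} {ha : a ≠ 0} (h : g * cuspMatrix c = cuspMatrix c' * upperTriangular a b ha)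
    {w : ℝ} (hw : IsCuspWidth Γ c w) : IsCuspWidth Γ c' (a ^ 2 * w) := by
  have ha2 : 0 < a ^ 2 := by positivity
  refine ⟨⟨mul_pos ha2 hw.1.1, ?_⟩, fun x ⟨hx0, hx⟩ => ?_⟩
  · rw [cuspTranslation_smul h]
    exact Γ.mul_mem (Γ.mul_mem hg hw.mem) (Γ.inv_mem hg)
  · have e : x = a ^ 2 * (x / a ^ 2) := by field_simp
    rw [e, cuspTranslation_smul h] at hx
    have h1 : cuspTranslation c (x / a ^ 2) ∈ Γ := by
      have := Γ.mul_mem (Γ.mul_mem (Γ.inv_mem hg) hx) hg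
      simpa [mul_assoc] using this
    have h2 := hw.2 ⟨div_pos hx0 ha2, h1⟩
    rw [e]
    exact mul_le_mul_of_nonneg_left h2 ha2.le

lemma IsCuspOf.smul_of_mem {Γ : Subgroup SL(2, ℝ)} {g : SL(2, ℝ)} (hg : g ∈ Γ) {c : OnePoint ℝ}
    (hc : IsCuspOf Γ c) : IsCuspOf Γ (Matrix.SpecialLinearGroup.toGL g • c) :=
  IsCusp.smul_of_mem hc (Subgroup.mem_map_of_mem _ hg)

/-- Expansions transform under `g`: the period and the exponents are rescaled. -/
lemma stroke_mem_logSeries {V : Type*} [NormedAddCommGroup V] [NormedSpace ℂ V] {𝓔 : Set (Set ℝ)}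
    (h𝓔 : IsExponentFamily 𝓔) (k : ℤ) {g : SL(2, ℝ)} {c c' : OnePoint ℝ} {a b : ℝ} {ha : a ≠ 0}
    (h : g * cuspMatrix c = cuspMatrix c' * upperTriangular a b ha) {w : ℝ} {E : Set ℝ}
    (hE : E ∈ 𝓔) {X : ℍ → V} (hX : stroke k (cuspMatrix c') X ∈ LogSeries V w E) :
    ∃ E' ∈ 𝓔, stroke k (cuspMatrix c) (stroke k g X) ∈ LogSeries V (w / a ^ 2) E' := by
  have ha2 : 0 < a ^ 2 := by positivity
  obtain ⟨E', hE', hEE'⟩ := h𝓔.scale E hE (a ^ 2) ha2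
  refine ⟨E', hE', ?_⟩
  rw [← stroke_mul, h, stroke_mul, stroke_upperTriangular]
  exact Submodule.smul_mem _ _
    (logSeries_comp_affine ha2.ne' hEE' (coe_upperTriangular_smul ha) hX)

/-! ### The lift and expansions at the cusps -/

section Forms

variable {κ ι : Type*} [Fintype κ] [DecidableEq κ] [Fintype ι] [DecidableEq ι]
variable {Γ Λ : Subgroup SL(2, ℝ)} {γ : κ → SL(2, ℝ)}

/-- A nonzero power of a parabolic element is parabolic with the same fixed point, and some power
lies in `Λ`. -/
lemma IsCosetReps.isCuspOf (hγ : IsCosetReps Γ Λ γ) {c : OnePoint ℝ} (hc : IsCuspOf Γ c) :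
    IsCuspOf Λ c := by
  obtain ⟨D, hD, hpow⟩ := hγ.exists_pow_mem
  obtain ⟨_, ⟨s, hs, rfl⟩, hp, hsc⟩ := hc
  refine ⟨_, Subgroup.mem_map_of_mem _ (hpow s hs), ?_⟩
  rw [map_pow]
  refine ⟨hp.pow hD.ne', ?_⟩
  rwa [(hp.pow hD.ne').smul_eq_self_iff, hp.parabolicFixedPoint_pow hD.ne',
    ← hp.smul_eq_self_iff]

/-- The right-hand side no longer involves `ρ`, which is what makes forms for `ρ` and for the
induced representation comparable. From right to left the functional equation at `t_c` supplies the
matrix. -/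
lemma expansionsAtCusps_iff {𝓔 : Set (Set ℝ)} {P : Matrix ι ι ℂ → (ℂ → ℕ → ℤ → ι → ℂ) → Prop}
    (hP : IsExponentCondition 𝓔 P) {ρ : Λ →* GL ι ℂ} {k : ℤ} {X : ℍ → ι → ℂ}
    (hX : ∀ g : Λ, stroke k g X = fun τ => (ρ g).val.mulVec (X τ)) :
    ExpansionsAtCusps ρ k P X ↔ ∀ c, IsCuspOf Λ c → ∀ h : ℝ, IsCuspWidth Λ c h →
      ∃ E ∈ 𝓔, stroke k (cuspMatrix c) X ∈ LogSeries (ι → ℂ) h E := by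
  constructor
  · intro H c hc h hh
    obtain ⟨a, ha, hPa⟩ := H c hc h hh
    exact mem_logSeries_of_isLogExpansion hP hh.1.1 ha hPa
  · intro H c hc h hh
    obtain ⟨E, hE, hF⟩ := H c hc h hh
    refine exists_isLogExpansion_of_mem_logSeries hP hh.1.1 (fun τ => ?_) hE hF
    rw [← stroke_translation k h (stroke k (cuspMatrix c) X), ← stroke_mul]
    have e : cuspMatrix c * translation h = cuspTranslation c h * cuspMatrix c := by
      rw [cuspTranslation]
      group
    rw [e, stroke_mul, hX ⟨_, hh.mem⟩, stroke_mulVec]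

lemma IsVVAF.lift (hγ : IsCosetReps Γ Λ γ) (hΛ : Λ ≤ Γ) {𝓔 : Set (Set ℝ)}
    (h𝓔 : IsExponentFamily 𝓔) {P : Matrix ι ι ℂ → (ℂ → ℕ → ℤ → ι → ℂ) → Prop}
    {Q : Matrix (κ × ι) (κ × ι) ℂ → (ℂ → ℕ → ℤ → κ × ι → ℂ) → Prop}
    (hP : IsExponentCondition 𝓔 P) (hQ : IsExponentCondition 𝓔 Q) {ρ : Λ →* GL ι ℂ} {k : ℤ}
    {X : ℍ → ι → ℂ} (hX : IsVVAF ρ k P X) :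
    IsVVAF (inducedRep hγ ρ) k Q (VVAF.lift k γ X) := by
  have hfun := functional_lift hγ hX.functional
  have hcusps := (expansionsAtCusps_iff hP hX.functional).1 hX.cusps
  refine ⟨mdifferentiable_pi.2 fun p => mdifferentiable_pi.1
    (mdifferentiable_stroke k (γ p.1)⁻¹ hX.holo) p.2, hfun,
    (expansionsAtCusps_iff hQ hfun).2 fun c hc h hh => ?_⟩
  have hblock : ∀ i, ∃ E ∈ 𝓔,
      stroke k (cuspMatrix c) (stroke k (γ i)⁻¹ X) ∈ LogSeries (ι → ℂ) h E := by
    intro i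
    have hg : (γ i)⁻¹ ∈ Γ := Γ.inv_mem (hγ.mem i)
    obtain ⟨a, b, ha, hab⟩ := exists_upperTriangular (γ i)⁻¹ c
    set c' := Matrix.SpecialLinearGroup.toGL (γ i)⁻¹ • c
    have hw : IsCuspWidth Γ c' (a ^ 2 * h) := hh.smul hg hab
    obtain ⟨D, hD, hpow⟩ := hγ.exists_pow_mem
    -- The `Λ`-width of `c'` is `w = n a² h`, a multiple of its `Γ`-width. Pulled back to `c`, the
    -- expansion of `X` has period `w / a² = n h`, which is finally refined to `h`.
    obtain ⟨w, n, hw', hn, hwn⟩ := exists_isLeast_of_nsmul_mem (A := widthGroup Λ c')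
      (B := widthGroup Γ c') one_pos (fun x hx => by rw [one_smul]; exact hΛ hx) hw
      ⟨D • (a ^ 2 * h), by
        rw [mem_widthGroup, cuspTranslation_nsmul]
        exact hpow _ hw.mem, nsmul_pos hw.1.1 hD.ne'⟩
    obtain ⟨E, hE, hXE⟩ := hcusps c' (hγ.isCuspOf (hc.smul_of_mem hg)) w hw'
    obtain ⟨E', hE', hmem⟩ := stroke_mem_logSeries h𝓔 k hab hE hXE
    refine ⟨E', hE', logSeries_change_period hn (D := 1) ?_ _ hmem⟩
    have ha2 : a ^ 2 ≠ 0 := by positivity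
    field_simp
    linear_combination hwn
  choose E hE hmem using hblock
  -- Directedness of the family gives one exponent set for all of the finitely many blocks.
  obtain ⟨E₀, hE₀, hsub⟩ : ∃ E₀ ∈ 𝓔, ∀ i, E i ⊆ E₀ := by
    have := h𝓔.nonempty.to_subtype
    obtain ⟨⟨E₀, h₀⟩, h₁⟩ :=
      (directedOn_iff_directed.1 h𝓔.directed).finite_le fun i => (⟨E i, hE i⟩ : 𝓔)
    exact ⟨E₀, h₀, h₁⟩
  refine ⟨E₀, hE₀, ?_⟩
  have e : stroke k (cuspMatrix c) (VVAF.lift k γ X) = ∑ i : κ, fun τ =>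
      (ContinuousLinearMap.pi fun p : κ × ι =>
        if p.1 = i then ContinuousLinearMap.proj p.2 else 0 : (ι → ℂ) →L[ℂ] (κ × ι → ℂ))
        (stroke k (cuspMatrix c) (stroke k (γ i)⁻¹ X) τ) := by
    funext τ ⟨i, x⟩
    rw [Finset.sum_apply, Finset.sum_apply, Finset.sum_eq_single i]
    · simp
      rfl
    · intro j _ hj
      simp [hj.symm]
    · simp
  rw [e]
  exact Submodule.sum_mem _ fun i _ =>
    logSeries_clm_comp _ (logSeries_mono (hsub i) (hmem i))

lemma IsVVAF.descend (hγ : IsCosetReps Γ Λ γ) (hΛ : Λ ≤ Γ) {𝓔 : Set (Set ℝ)}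
    (h𝓔 : IsExponentFamily 𝓔) {P : Matrix ι ι ℂ → (ℂ → ℕ → ℤ → ι → ℂ) → Prop}
    {Q : Matrix (κ × ι) (κ × ι) ℂ → (ℂ → ℕ → ℤ → κ × ι → ℂ) → Prop}
    (hP : IsExponentCondition 𝓔 P) (hQ : IsExponentCondition 𝓔 Q) {ρ : Λ →* GL ι ℂ} {k : ℤ}
    {Y : ℍ → κ × ι → ℂ} (hY : IsVVAF (inducedRep hγ ρ) k Q Y) (i : κ) :
    IsVVAF ρ k P (VVAF.descend k γ i Y) := by
  have hfun := functional_descend hγ hΛ hY.functional i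
  have hcusps := (expansionsAtCusps_iff hQ hY.functional).1 hY.cusps
  refine ⟨mdifferentiable_stroke k (γ i) (mdifferentiable_pi.2 fun x =>
    mdifferentiable_pi.1 hY.holo (i, x)), hfun,
    (expansionsAtCusps_iff hP hfun).2 fun c hc h hh => ?_⟩
  obtain ⟨a, b, ha, hab⟩ := exists_upperTriangular (γ i) c
  set c' := Matrix.SpecialLinearGroup.toGL (γ i) • c
  obtain ⟨D, hD, hpow⟩ := hγ.exists_pow_mem
  -- Here the given width `h` belongs to `Λ`, and the `Γ`-width `w` of `c` exists because `D`-th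
  -- powers of elements of `Γ` fall into `Λ`; the two are related by `D w = n h`.
  obtain ⟨w, n, hw, hn, hwn⟩ := exists_isLeast_of_nsmul_mem (A := widthGroup Γ c)
    (B := widthGroup Λ c) hD (fun x hx => by
      rw [mem_widthGroup, cuspTranslation_nsmul]
      exact hpow _ hx) hh ⟨h, hΛ hh.mem, hh.1.1⟩
  have hw' : IsCuspWidth Γ c' (a ^ 2 * w) := IsCuspWidth.smul (hγ.mem i) hab hw
  have hc' : IsCuspOf Γ c := hc.mono (Subgroup.map_mono hΛ)
  obtain ⟨E, hE, hYE⟩ := hcusps c' (hc'.smul_of_mem (hγ.mem i)) _ hw'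
  have hblock : stroke k (cuspMatrix c') (block i Y) ∈ LogSeries (ι → ℂ) (a ^ 2 * w) E :=
    logSeries_clm_comp
      (ContinuousLinearMap.pi fun x : ι => ContinuousLinearMap.proj (R := ℂ) (i, x)) hYE
  obtain ⟨E', hE', hmem⟩ := stroke_mem_logSeries h𝓔 k hab hE hblock
  rw [mul_div_cancel_left₀ _ (by positivity)] at hmem
  exact ⟨E', hE', logSeries_change_period hn hwn _ hmem⟩

end Forms

/-! ### The lift as a linear equivalence -/

section Forms

variable {κ ι : Type*} [Fintype κ] [DecidableEq κ] [Fintype ι] [DecidableEq ι]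
variable {Γ Λ : Subgroup SL(2, ℝ)} {γ : κ → SL(2, ℝ)}

lemma isVVAF_lift_iff (hγ : IsCosetReps Γ Λ γ) (hΛ : Λ ≤ Γ) {𝓔 : Set (Set ℝ)}
    (h𝓔 : IsExponentFamily 𝓔) {P : Matrix ι ι ℂ → (ℂ → ℕ → ℤ → ι → ℂ) → Prop}
    {Q : Matrix (κ × ι) (κ × ι) ℂ → (ℂ → ℕ → ℤ → κ × ι → ℂ) → Prop}
    (hP : IsExponentCondition 𝓔 P) (hQ : IsExponentCondition 𝓔 Q) {ρ : Λ →* GL ι ℂ} {k : ℤ}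
    {X : ℍ → ι → ℂ} : IsVVAF (inducedRep hγ ρ) k Q (VVAF.lift k γ X) ↔ IsVVAF ρ k P X := by
  refine ⟨fun h => ?_, fun h => h.lift hγ hΛ h𝓔 hP hQ⟩
  obtain ⟨i⟩ := hγ.nonempty
  have := h.descend hγ hΛ h𝓔 hP hQ i
  rwa [descend_lift] at this

lemma lift_add (k : ℤ) (X Y : ℍ → ι → ℂ) :
    VVAF.lift k γ (X + Y) = VVAF.lift k γ X + VVAF.lift k γ Y := by
  funext τ p
  simp [VVAF.lift, stroke_add]

lemma lift_smul (k : ℤ) (w : ℂ) (X : ℍ → ι → ℂ) :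
    VVAF.lift k γ (w • X) = w • VVAF.lift k γ X := by
  funext τ p
  simp only [VVAF.lift, stroke, Pi.smul_apply, smul_comm _ w]

/-- Invariance of `f` under the representatives `γ_i` is used, which is why the scalars are forms on
`Γ` and not merely on `Λ`. -/
lemma lift_mul (hγ : IsCosetReps Γ Λ γ) (k : ℤ) {f : ℍ → ℂ} (hf : IsScalarForm Γ f)
    (X : ℍ → ι → ℂ) : VVAF.lift k γ (f • X) = f • VVAF.lift k γ X := by
  funext τ p
  simp only [VVAF.lift]
  rw [stroke_mul_of_invariant k _ (hf.invariant _ (Γ.inv_mem (hγ.mem p.1)))]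
  rfl

/-- The lift as an isomorphism between two modules of forms. -/
def liftEquiv {R : Type*} [Semiring R] [Module R (ℍ → ι → ℂ)] [Module R (ℍ → κ × ι → ℂ)]
    (k : ℤ) (γ : κ → SL(2, ℝ)) (M : Submodule R (ℍ → ι → ℂ)) (N : Submodule R (ℍ → κ × ι → ℂ))
    (i : κ) (hsmul : ∀ (r : R) (X : ℍ → ι → ℂ), VVAF.lift k γ (r • X) = r • VVAF.lift k γ X)
    (hMN : ∀ X ∈ M, VVAF.lift k γ X ∈ N) (hNM : ∀ Y ∈ N, descend k γ i Y ∈ M)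
    (hN : ∀ Y ∈ N, VVAF.lift k γ (descend k γ i Y) = Y) : M ≃ₗ[R] N where
  toFun X := ⟨VVAF.lift k γ X, hMN X X.2⟩
  map_add' _ _ := Subtype.ext (lift_add k _ _)
  map_smul' r _ := Subtype.ext (hsmul r _)
  invFun Y := ⟨descend k γ i Y, hNM Y Y.2⟩
  left_inv _ := Subtype.ext (descend_lift k i _)
  right_inv Y := Subtype.ext (hN Y Y.2)

lemma descend_of_eq_one (k : ℤ) {i : κ} (hi : γ i = 1) (Y : ℍ → κ × ι → ℂ) :
    descend k γ i Y = block i Y := by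
  rw [descend, hi, stroke_one]

/-- The lift of complex vector spaces of forms, and its compatibility with multiplication by
scalar-valued forms. -/
lemma exists_liftEquiv (hγ : IsCosetReps Γ Λ γ) (hΛ : Λ ≤ Γ) {𝓔 : Set (Set ℝ)}
    (h𝓔 : IsExponentFamily 𝓔) {P : Matrix ι ι ℂ → (ℂ → ℕ → ℤ → ι → ℂ) → Prop}
    {Q : Matrix (κ × ι) (κ × ι) ℂ → (ℂ → ℕ → ℤ → κ × ι → ℂ) → Prop}
    (hP : IsExponentCondition 𝓔 P) (hQ : IsExponentCondition 𝓔 Q) {ρ : Λ →* GL ι ℂ} {k : ℤ}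
    {M : Submodule ℂ (ℍ → ι → ℂ)} {N : Submodule ℂ (ℍ → κ × ι → ℂ)}
    (hM : ∀ X, X ∈ M ↔ IsVVAF ρ k P X) (hN : ∀ Y, Y ∈ N ↔ IsVVAF (inducedRep hγ ρ) k Q Y)
    (i : κ) :
    ∃ Φ : M ≃ₗ[ℂ] N,
      (∀ X, (Φ X : ℍ → κ × ι → ℂ) = VVAF.lift k γ X) ∧
      (γ i = 1 → ∀ Y, (Φ.symm Y : ℍ → ι → ℂ) = block i Y) ∧
      ∀ f ∈ scalarRing Γ, ∀ X : M,
        (f • (X : ℍ → ι → ℂ) ∈ M ↔ f • (Φ X : ℍ → κ × ι → ℂ) ∈ N) ∧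
        ∀ X' : M, (X' : ℍ → ι → ℂ) = f • (X : ℍ → ι → ℂ) →
          (Φ X' : ℍ → κ × ι → ℂ) = f • (Φ X : ℍ → κ × ι → ℂ) := by
  refine ⟨liftEquiv k γ M N i (lift_smul k)
    (fun X hX => (hN _).2 (((hM X).1 hX).lift hγ hΛ h𝓔 hP hQ))
    (fun Y hY => (hM _).2 (((hN Y).1 hY).descend hγ hΛ h𝓔 hP hQ i))
    (fun Y hY => lift_descend hγ ((hN Y).1 hY).functional i), fun X => rfl,
    fun hi Y => descend_of_eq_one k hi Y.1, fun f hf X => ⟨?_, fun X' hX' => ?_⟩⟩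
  · change _ ↔ f • VVAF.lift k γ X.1 ∈ N
    -- The lift detects membership in both directions for arbitrary functions, so it may be applied
    -- to `f • X` before that product is known to be a form.
    rw [← lift_mul hγ k hf, hM, hN, isVVAF_lift_iff hγ hΛ h𝓔 hP hQ]
  · change VVAF.lift k γ X'.1 = f • VVAF.lift k γ X.1
    rw [hX', lift_mul hγ k hf]

end Forms

lemma neg_one_mem_preimageSL (G : Subgroup PSL(2, ℝ)) : (-1 : SL(2, ℝ)) ∈ preimageSL G := by
  have h : (-1 : SL(2, ℝ)) ∈ Subgroup.center SL(2, ℝ) :=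
    Subgroup.mem_center_iff.2 fun g => by simp
  have h1 : QuotientGroup.mk' (Subgroup.center SL(2, ℝ)) (-1) = 1 :=
    (QuotientGroup.eq_one_iff _).2 h
  rw [preimageSL, Subgroup.mem_comap, h1]
  exact G.one_mem

end VVAF

end

open VVAF
theorem mainTheorem3
    (G H : Subgroup PSL(2, ℝ)) (hG : IsFuchsianFirstKind G) (hHG : H ≤ G)
    {m d : ℕ} [NeZero d]
    (γ : Fin d → SL(2, ℝ)) (hγ : IsCosetReps (preimageSL G) (preimageSL H) γ)
    (ρ : preimageSL H →* GL (Fin m) ℂ) (hρ : UnitaryAtParabolics ρ) (k : ℤ) :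
    -- the induced representation satisfies the standing assumptions made on `ρ`
    (UnitaryAtParabolics (inducedRep hγ ρ) ∧
      (IsLogarithmic ρ → IsLogarithmic (inducedRep hγ ρ)) ∧
      (IsCompatible ρ k ↔ IsCompatible (inducedRep hγ ρ) k)) ∧
    -- weakly holomorphic forms of weight `k`
    (∃ Φ : weaklyHolForms (preimageSL_mono hHG) k ρ ≃ₗ[scalarRing (preimageSL G)]
        weaklyHolForms (le_refl (preimageSL G)) k (inducedRep hγ ρ),
      (∀ X, (Φ X : ℍ → Fin d × Fin m → ℂ) = lift k γ X) ∧
      (γ 0 = 1 → ∀ Y, (Φ.symm Y : ℍ → Fin m → ℂ) = block (0 : Fin d) Y)) ∧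
    -- holomorphic forms of weight `0`
    (∃ Φ : holForms 0 ρ ≃ₗ[ℂ] holForms 0 (inducedRep hγ ρ),
      (∀ X, (Φ X : ℍ → Fin d × Fin m → ℂ) = lift 0 γ X) ∧
      (γ 0 = 1 → ∀ Y, (Φ.symm Y : ℍ → Fin m → ℂ) = block (0 : Fin d) Y) ∧
      ∀ f ∈ scalarRing (preimageSL G), ∀ X : holForms 0 ρ,
        (f • (X : ℍ → Fin m → ℂ) ∈ holForms 0 ρ ↔
          f • (Φ X : ℍ → Fin d × Fin m → ℂ) ∈ holForms 0 (inducedRep hγ ρ)) ∧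
        ∀ X' : holForms 0 ρ, (X' : ℍ → Fin m → ℂ) = f • (X : ℍ → Fin m → ℂ) →
          (Φ X' : ℍ → Fin d × Fin m → ℂ) = f • (Φ X : ℍ → Fin d × Fin m → ℂ)) ∧
    -- cusp forms of weight `0`
    (∃ Φ : cuspForms 0 ρ ≃ₗ[ℂ] cuspForms 0 (inducedRep hγ ρ),
      (∀ X, (Φ X : ℍ → Fin d × Fin m → ℂ) = lift 0 γ X) ∧
      (γ 0 = 1 → ∀ Y, (Φ.symm Y : ℍ → Fin m → ℂ) = block (0 : Fin d) Y) ∧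
      ∀ f ∈ scalarRing (preimageSL G), ∀ X : cuspForms 0 ρ,
        (f • (X : ℍ → Fin m → ℂ) ∈ cuspForms 0 ρ ↔
          f • (Φ X : ℍ → Fin d × Fin m → ℂ) ∈ cuspForms 0 (inducedRep hγ ρ)) ∧
        ∀ X' : cuspForms 0 ρ, (X' : ℍ → Fin m → ℂ) = f • (X : ℍ → Fin m → ℂ) →
          (Φ X' : ℍ → Fin d × Fin m → ℂ) = f • (Φ X : ℍ → Fin d × Fin m → ℂ)) := by
  have hΛ := preimageSL_mono hHG
  refine ⟨⟨unitaryAtParabolics_inducedRep hγ hρ, isLogarithmic_inducedRep hγ hΛ,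
    isCompatible_inducedRep_iff hγ hΛ (neg_one_mem_preimageSL H) ρ k⟩, ?_, ?_, ?_⟩
  · exact ⟨liftEquiv k γ _ _ 0 (fun f X => lift_mul hγ k f.2 X)
      (fun X hX => IsVVAF.lift hγ hΛ isExponentFamily_range_Ici isExponentCondition_meromorphic
        isExponentCondition_meromorphic hX)
      (fun Y hY => IsVVAF.descend hγ hΛ isExponentFamily_range_Ici
        isExponentCondition_meromorphic isExponentCondition_meromorphic hY 0)
      (fun Y hY => lift_descend hγ (IsVVAF.functional hY) 0),
      fun X => rfl, fun h0 Y => descend_of_eq_one k h0 Y.1⟩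
  · exact exists_liftEquiv hγ hΛ isExponentFamily_Ici isExponentCondition_holomorphic
      isExponentCondition_holomorphic (fun _ => Iff.rfl) (fun _ => Iff.rfl) 0
  · exact exists_liftEquiv hγ hΛ isExponentFamily_Ioi isExponentCondition_cuspidal
      isExponentCondition_cuspidal (fun _ => Iff.rfl) (fun _ => Iff.rfl) 0
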